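/- Let $X$ be a finite-dimensional real inner product space and $\Omega\subset X$ a closed convex cone which is pointed ($\Omega\cap-\Omega=0$) and solid (has non-empty interior), with dual cone $\Omega^*=\{y\in X:\langle x,y\rangle\ge 0\ \forall x\in\Omega\}$. Let $\{0=n_0<n_1<\dots<n_d=\dim X\}$ be the set of dimensions of the (non-empty, convex) faces of $\Omega^*$, and for $0\le j\le d$ let $P_j$ be the set of $n_{d-j}$-dimensional faces of $\Omega^*$, with the topology induced by the Fell topology on the space of closed subsets of $X$. For $1\le j\le d$ let $$\mathcal P_j=\{(E,F)\in P_{j-1}\times P_j : E\supset F\},\qquad \xi:\mathcal P_j\to P_{j-1},\quad \xi(E,F)=E .$$ For $A\subset X$ let $\langle A\rangle$ be its linear span, $A^\perp$ its orthogonal complement, $A^*$ its dual cone and $A^\circledast=A^*\cap\langle A\rangle$. Assume that $\Omega^*$ is *facially compact*, i.e. all $P_j$, $0\le j\le d$, are compact, and *locally smooth*, i.e. the following holds for every face $E$ of $\Omega^*$ and every face $F\subset E$ of $\Omega^*$ with $\dim F=\max\{\dim G: G\text{ a face of }\Omega^*,\ \dim G<\dim E\}$: every point $x$ of the relative interior of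 $F$ is a regular point of $E$, that is, there is exactly one supporting hyperplane of $E$ in $\langle E\rangle$ through $x$. For $(E,F)\in\mathcal P_j$, the relative dual face $F^\perp\cap E^\circledast$ is then a ray; let $\mathbf e(E,F)=e_F(E)$ be its unit generator, and put $$E_{1/2}(F)=\langle E\rangle\cap F^\perp\cap (F^\perp\cap E^\circledast)^\perp .$$ A continuous fibre-preserving map $(y,v)\mapsto (y,f^y(v))$ between open subsets $A\subset Y\times V$ and $B\subset Y\times W$, with $V,W$ finite-dimensional real vector spaces, is of class $\mathcal C^{1,0}$ if for all open $U\subset Y$, $V'\subset V$ with $U\times V'\subset A$, the map $y\mapsto f^y|_{V'}$ is well defined and continuous from $U$ to the space of $\mathcal C^1$ maps on $V'$, with the topology of uniform convergence of functions and first derivatives on compact sets. A *$\mathcal C^{1,0}$ manifold over $Y$* is a continuous open surjection $p:M\to Y$ of paracompact locally compact Hausdorff spaces with an atlas of fibre-preserving charts onto open subsets of $Y\times\mathbb R^k$ whose transition maps and their inverses are of class $\mathcal C^{1,0}$. A *$\mathcal C^{1,0}$ submanifold* (of fibre dimension $k$) of $Y\times X$ is a subset $S$ such that around each of its points there is a $\mathcal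 C^{1,0}$ chart of $Y\times X$ which maps $S$ to $Y\times L$ for a $k$-dimensional linear subspace $L\subset X$. **Theorem.** Let $1\le j\le d$ and $k=n_{d-j+1}-n_{d-j}-1$. The product $\xi(\mathcal P_j)\times X$ is a $\mathcal C^{1,0}$ manifold over $\xi(\mathcal P_j)$ with respect to the first projection, and the image of $\mathcal P_j$ under $(\xi,\mathbf e):\mathcal P_j\to\xi(\mathcal P_j)\times X$ is a closed $\mathcal C^{1,0}$ submanifold of it, of fibre dimension $k$. Moreover, $(\xi,\mathbf e)$ is a homeomorphism onto its image, and this defines a $\mathcal C^{1,0}$ manifold structure on $\mathcal P_j$ over $\xi(\mathcal P_j)$: the charts are the fibre-preserving homeomorphisms $\varphi$ from open subsets of $\mathcal P_j$ onto open subsets of $\xi(\mathcal P_j)\times\mathbb R^k$ for which $\mathbf e\circ\varphi^{-1}$ is of class $\mathcal C^{1,0}$ with injective fibrewise derivative. The fibrewise tangent space of $\mathcal P_j$ at $(E,F)$, identified with its image in $X$ under the fibrewise differential of $\mathbf e$, is $E_{1/2}(F)$. -/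

import Mathlib

noncomputable section

/-! ## The Fell topology on the closed subsets of a space -/

/-- The set of all closed subsets of `X` (the empty set included). -/
def ClosedSubsets (X : Type*) [TopologicalSpace X] : Type _ := {A : Set X // IsClosed A}

namespace ClosedSubsets

variable {X : Type*} [TopologicalSpace X]

/-- The underlying set of points. -/
def carrier (A : ClosedSubsets X) : Set X := A.1

/-- The Fell topology: it is generated by the sets `{A | A ∩ K = ∅}`, `K` compact, and
`{A | A ∩ U ≠ ∅}`, `U` open. -/
instance fellTopology : TopologicalSpace (ClosedSubsets X) :=
  TopologicalSpace.generateFrom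
    ({S | ∃ K : Set X, IsCompact K ∧ S = {A | A.carrier ∩ K = ∅}} ∪
      {S | ∃ U : Set X, IsOpen U ∧ S = {A | (A.carrier ∩ U).Nonempty}})

end ClosedSubsets

/-! ## Faces of convex cones -/

namespace ConeFace

variable {X : Type*} [NormedAddCommGroup X] [InnerProductSpace ℝ X]

open scoped RealInnerProductSpace

/-- The dual cone `Ω* = {y | ⟪x, y⟫ ≥ 0 for all x ∈ Ω}`, as a set. -/
def dualCone [CompleteSpace X] (Ω : ProperCone ℝ X) : Set X :=
  (ProperCone.innerDual (Ω : Set X) : Set X)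

/-- `F` is a (non-empty, convex) face of the convex set `C`. -/
structure IsFace (C F : Set X) : Prop where
  nonempty : F.Nonempty
  convex : Convex ℝ F
  extreme : IsExtreme ℝ C F

/-- The dimension of a cone (or of a face of a cone): the dimension of its linear span. -/
def dim (A : Set X) : ℕ := Module.finrank ℝ (Submodule.span ℝ A)

/-- The set of the dimensions of the faces of `C`. -/
def faceDims (C : Set X) : Set ℕ := {m | ∃ F, IsFace C F ∧ dim F = m}

/-- The number `d`, where `n_0 < n_1 < ⋯ < n_d` are the dimensions of the faces of `C`. -/
def depth (C : Set X) : ℕ := (faceDims C).ncard - 1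

/-- The number `n_i`, where `n_0 < n_1 < ⋯ < n_d` are the dimensions of the faces of `C`
(meaningful for `i ≤ depth C`). -/
def faceDim (C : Set X) (i : ℕ) : ℕ := Nat.nth (fun m => m ∈ faceDims C) i

/-- `P_j`, the set of the faces of `C` of dimension `n_{d-j}` (for `j ≤ d = depth C`), as a subset
of the space of closed subsets of `X`. -/
def facesAt (C : Set X) (j : ℕ) : Set (ClosedSubsets X) :=
  {F | IsFace C F.carrier ∧ dim F.carrier = faceDim C (depth C - j)}

/-- `C` is facially compact: `P_j` is compact in the Fell topology for `0 ≤ j ≤ d`. -/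
def FaciallyCompact (C : Set X) : Prop := ∀ j ≤ depth C, IsCompact (facesAt C j)

/-- The relative dual cone `E^⊛`, i.e. the dual cone of `E` inside the linear span of `E`. -/
def relDual [CompleteSpace X] (E : Set X) : Set X :=
  (ProperCone.innerDual E : Set X) ∩ (Submodule.span ℝ E : Set X)

/-- The relative dual face `F^⊥ ∩ E^⊛`. -/
def relDualFace [CompleteSpace X] (E F : Set X) : Set X :=
  ((Submodule.span ℝ F)ᗮ : Set X) ∩ relDual E

/-- `H` is a supporting hyperplane at `x` of the cone `E`, relative to the linear span of `E`. -/
def IsSupportingHyperplane [CompleteSpace X] (E : Set X) (x : X) (H : Submodule ℝ X) : Prop :=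
  ∃ ν ∈ relDual E, ν ≠ 0 ∧ ⟪ν, x⟫ = 0 ∧ H = Submodule.span ℝ E ⊓ (Submodule.span ℝ {ν})ᗮ

/-- `x` is a regular point of the cone `E`: there is a unique supporting hyperplane at `x`. -/
def IsRegularPoint [CompleteSpace X] (E : Set X) (x : X) : Prop :=
  ∃! H : Submodule ℝ X, IsSupportingHyperplane E x H

/-- `F` is a face of `C` contained in `E` which is maximal dimensional relative `C`, i.e.
`dim F = max {dim G | G a face of C, dim G < dim E}`. -/
def IsMaxDimIn (C E F : Set X) : Prop :=
  IsFace C F ∧ F ⊆ E ∧ IsGreatest {m | m ∈ faceDims C ∧ m < dim E} (dim F)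

/-- The face `E` of `C` is modular: it contains a face which is maximal dimensional relative `C`. -/
def IsModular (C E : Set X) : Prop := IsFace C E ∧ ∃ F, IsMaxDimIn C E F

/-- The modular face `E` of `C` is smooth: the relative interior of each face `F ⊊ E` which is
maximal dimensional relative `C` consists of regular points of `E`. -/
def IsSmoothFace [CompleteSpace X] (C E : Set X) : Prop :=
  ∀ F, IsMaxDimIn C E F → F ≠ E → ∀ x ∈ intrinsicInterior ℝ F, IsRegularPoint E x

/-- `C` is locally smooth: all of its modular faces are smooth. -/
def LocallySmooth [CompleteSpace X] (C : Set X) : Prop :=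
  ∀ E, IsModular C E → IsSmoothFace C E

/-- The space `𝒫_j` of all pairs `(E, F) ∈ P_{j-1} × P_j` with `E ⊇ F` (for `1 ≤ j ≤ d`). -/
def flags (C : Set X) (j : ℕ) : Set (ClosedSubsets X × ClosedSubsets X) :=
  {q | q.1 ∈ facesAt C (j - 1) ∧ q.2 ∈ facesAt C j ∧ q.2.carrier ⊆ q.1.carrier}

/-- The image `ξ(𝒫_j) ⊆ P_{j-1}` of the projection `ξ : (E, F) ↦ E`. -/
def flagBase (C : Set X) (j : ℕ) : Set (ClosedSubsets X) := Prod.fst '' flags C j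

/-- The projection `ξ : 𝒫_j → ξ(𝒫_j)`, `(E, F) ↦ E`. -/
def flagProj (C : Set X) (j : ℕ) (q : flags C j) : flagBase C j :=
  ⟨q.1.1, Set.mem_image_of_mem Prod.fst q.2⟩

/-- `e` is a normalised generator of the relative dual face `F^⊥ ∩ E^⊛`: it has norm one, and
`F^⊥ ∩ E^⊛` is the ray spanned by `e`. -/
def IsNormalisedGenerator [CompleteSpace X] (E F : Set X) (e : X) : Prop :=
  ‖e‖ = 1 ∧ relDualFace E F = {x | ∃ t : ℝ, 0 ≤ t ∧ x = t • e}

/-- `e_F(E)`, the normalised generator of the relative dual face `F^⊥ ∩ E^⊛` (an arbitrary vector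
if there is none; it is unique if it exists). -/
def normGen [CompleteSpace X] (E F : Set X) : X := Classical.epsilon (IsNormalisedGenerator E F)

/-- The map `(ξ, 𝐞) : 𝒫_j → ξ(𝒫_j) × X`, `(E, F) ↦ (E, e_F(E))`. -/
def flagMap [CompleteSpace X] (C : Set X) (j : ℕ) (q : flags C j) : flagBase C j × X :=
  (flagProj C j q, normGen q.1.1.carrier q.1.2.carrier)

/-- The number `n_{d-j+1} - n_{d-j} - 1` (for `1 ≤ j ≤ d`), the dimension of the fibres of `ξ`. -/
def fibreDim (C : Set X) (j : ℕ) : ℕ :=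
  faceDim C (depth C - (j - 1)) - faceDim C (depth C - j) - 1

/-- The space `E_{1/2}(F) = ⟨E⟩ ∩ F^⊥ ∩ (F^⊥ ∩ E^⊛)^⊥`, with `⟨E⟩` the linear span of `E`. -/
def halfSpace [CompleteSpace X] (E F : Set X) : Submodule ℝ X :=
  Submodule.span ℝ E ⊓ (Submodule.span ℝ F)ᗮ ⊓ (Submodule.span ℝ (relDualFace E F))ᗮ

end ConeFace

/-! ## Manifolds of class `C^{1,0}` over a base space -/

namespace FibrewiseC1

variable {Y M V W X : Type*} [TopologicalSpace Y] [TopologicalSpace M]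
  [NormedAddCommGroup V] [NormedSpace ℝ V] [NormedAddCommGroup W] [NormedSpace ℝ W]
  [NormedAddCommGroup X] [NormedSpace ℝ X]

/-- The fibre component `f` of a continuous fibre-preserving map `(y, v) ↦ (y, f (y, v))` on an open
set `A ⊆ Y × V` is of class `C^{1,0}`: for all `U × V' ⊆ A` with `U`, `V'` open,
`y ↦ f (y, ·)` is a well-defined and continuous map from `U` to `C^1(V')`, the latter with the
topology of uniform convergence of functions and first derivatives on compact sets. -/
def IsC10On (f : Y × V → W) (A : Set (Y × V)) : Prop :=
  ContinuousOn f A ∧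
  ∀ (U : Set Y) (V' : Set V), IsOpen U → IsOpen V' → U ×ˢ V' ⊆ A →
    (∀ y ∈ U, ContDiffOn ℝ 1 (fun v => f (y, v)) V') ∧
    ∀ y₀ ∈ U, ∀ K ⊆ V', IsCompact K →
      TendstoUniformlyOn (fun y v => f (y, v)) (fun v => f (y₀, v)) (nhds y₀) K ∧
      TendstoUniformlyOn (fun y v => fderiv ℝ (fun w => f (y, w)) v)
        (fun v => fderiv ℝ (fun w => f (y₀, w)) v) (nhds y₀) K

/-- The local homeomorphism `Φ` belongs to the pseudogroup of fibre-preserving local homeomorphisms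
of class `C^{1,0}` with inverse of class `C^{1,0}`. -/
structure IsC10Iso (Φ : OpenPartialHomeomorph (Y × V) (Y × V)) : Prop where
  fst_eq : ∀ z ∈ Φ.source, (Φ z).1 = z.1
  c10 : IsC10On (fun z => (Φ z).2) Φ.source
  c10_symm : IsC10On (fun z => (Φ.symm z).2) Φ.target

/-- `p : M → Y`, with the atlas `𝒜` of fibre-preserving charts in `Y × V`, is a manifold of class
`C^{1,0}` over `Y`. -/
structure IsC10Manifold (p : M → Y) (𝒜 : Set (OpenPartialHomeomorph M (Y × V))) : Prop where
  t2_total : T2Space M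
  locallyCompact_total : LocallyCompactSpace M
  paracompact_total : ParacompactSpace M
  t2_base : T2Space Y
  locallyCompact_base : LocallyCompactSpace Y
  paracompact_base : ParacompactSpace Y
  continuous : Continuous p
  isOpenMap : IsOpenMap p
  surjective : Function.Surjective p
  fst_eq : ∀ φ ∈ 𝒜, ∀ m ∈ φ.source, (φ m).1 = p m
  cover : ∀ m : M, ∃ φ ∈ 𝒜, m ∈ φ.source
  compatible : ∀ φ ∈ 𝒜, ∀ ψ ∈ 𝒜, IsC10Iso (φ.symm.trans ψ)

/-- The atlas of the product manifold `Y × V` over `Y`: the identity is a global chart. -/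
def productAtlas (Y V : Type*) [TopologicalSpace Y] [NormedAddCommGroup V] :
    Set (OpenPartialHomeomorph (Y × V) (Y × V)) := {OpenPartialHomeomorph.refl (Y × V)}

/-- `S` is a `C^{1,0}` submanifold of the product manifold `Y × X` over `Y`, with fibres of
dimension `k`: near each of its points, there is a chart of class `C^{1,0}` of `Y × X` which maps
`S` to `Y × L`, where `L` is a `k`-dimensional linear subspace of `X`. -/
def IsC10Submanifold (k : ℕ) (S : Set (Y × X)) : Prop :=
  ∀ s ∈ S, ∃ (Φ : OpenPartialHomeomorph (Y × X) (Y × X)) (L : Submodule ℝ X),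
    IsC10Iso Φ ∧ s ∈ Φ.source ∧ Module.finrank ℝ L = k ∧ ∀ z ∈ Φ.source, z ∈ S ↔ (Φ z).2 ∈ L

/-- The fibrewise derivative, at the point `z` of the chart domain, of the inverse of the chart
`φ` of `M` followed by the map `ι : M → Y × X` over `Y`. -/
def fibreDeriv (ι : M → Y × X) (φ : OpenPartialHomeomorph M (Y × V)) (z : Y × V) : V →L[ℝ] X :=
  fderiv ℝ (fun v => (ι (φ.symm (z.1, v))).2) z.2

/-- The atlas on `M` defined by a map `ι : M → Y × X` onto a submanifold of fibre
dimension `k`: it consists of all fibre-preserving local homeomorphisms `φ` from `M` to `Y × ℝ^k`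
such that `φ⁻¹` followed by `ι` is of class `C^{1,0}` and fibrewise immersive. -/
def inducedAtlas (k : ℕ) (ι : M → Y × X) :
    Set (OpenPartialHomeomorph M (Y × EuclideanSpace ℝ (Fin k))) :=
  {φ | (∀ m ∈ φ.source, (φ m).1 = (ι m).1) ∧
    IsC10On (fun z => (ι (φ.symm z)).2) φ.target ∧
    ∀ z ∈ φ.target, Function.Injective (fibreDeriv ι φ z)}

/-- The image in `X`, under the fibrewise differential of `ι : M → Y × X`, of the fibrewise tangent
space of `M` at `m`, computed in the chart `φ`. -/
def fibreTangentSpace (ι : M → Y × X) (φ : OpenPartialHomeomorph M (Y × V)) (m : M) :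
    Submodule ℝ X := (fibreDeriv ι φ (φ m)).toLinearMap.range

end FibrewiseC1

end

/-! Through `(ξ, 𝐞)` a fibre of `𝒫_j` becomes a set of unit vectors in `X`. Local smoothness makes
`e_F(E)` the only unit vector in its relative dual face; as the conditions defining it are closed in
the Fell topology, it is continuous in the flag (`continuous_gen`). The rest follows from two facts
about flags near a fixed `(E, F)` with `e = e_F(E)`, both uniform in the base point.

Secants. Differences `e₂ - e₁` of generators over one nearby base point tend to `E_{1/2}(F)`
(`isLittleO_secant`). They become orthogonal to `⟨E⟩^⊥` since they lie in a nearby span, to `e`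
since they are chords of the unit sphere, and to `F` since each point of `F` is approximated by
points of both smaller faces, on which `e₂ - e₁` has opposite signs (`isLittleO_inner_of_mem_bot`).
Hence the projection to `E_{1/2}(F)` is injective with Lipschitz inverse on nearby fibres.

Filling. These projections cover a neighbourhood of zero (`eventually_exists_starProjection_eq`).
For `x₀` in the relative interior of `F`, the distance from `x₀ - e + τ` to `E`, `τ ∈ E_{1/2}(F)`,
has a strict minimum at `τ = 0`. So for `E'` near `E` and small `p`, the distance to `E'` plus `⟪p,
τ⟫` still has a local minimum near zero. There the normalised residual of the nearest point of `E'`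
is a supporting functional whose projection is `p`. It generates the relative dual face of a nearby
flag by facial compactness (`eventually_exists_flag`): a face of dimension at most `dim F` passes
near `x₀` only if it is near `F`.

`HasSecantSpaces` isolates these facts. Base point and projection then form a chart, the limits of
secants give its fibrewise derivatives, and the image is locally a graph. Transition maps of the
induced atlas are handled by the inverse function theorem in each fibre. -/

namespace ClosedSubsets

/-! ### Closed relations and continuity in the Fell topology. -/

open Topology Filter Set

variable {X : Type*} [TopologicalSpace X]

theorem isClosed_carrier (A : ClosedSubsets X) : IsClosed A.carrier := A.2

theorem ext_carrier {A B : ClosedSubsets X} (h : A.carrier = B.carrier) : A = B := Subtype.ext h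

theorem isOpen_miss {K : Set X} (hK : IsCompact K) :
    IsOpen {A : ClosedSubsets X | A.carrier ∩ K = ∅} :=
  TopologicalSpace.isOpen_generateFrom_of_mem (Or.inl ⟨K, hK, rfl⟩)

theorem isOpen_hit {U : Set X} (hU : IsOpen U) :
    IsOpen {A : ClosedSubsets X | (A.carrier ∩ U).Nonempty} :=
  TopologicalSpace.isOpen_generateFrom_of_mem (Or.inr ⟨U, hU, rfl⟩)

/-- Each point of a closed set is approximated by points of nearby closed sets. -/
theorem eventually_hit {A : ClosedSubsets X} {x : X} (hx : x ∈ A.carrier) {s : Set X}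
    (hs : s ∈ 𝓝 x) : ∀ᶠ B in 𝓝 A, ∃ y ∈ B.carrier, y ∈ s := by
  obtain ⟨U, hUs, hU, hxU⟩ := mem_nhds_iff.1 hs
  filter_upwards [(isOpen_hit hU).mem_nhds (show A ∈ _ from ⟨x, hx, hxU⟩)] with B hB
  obtain ⟨y, hy, hyU⟩ := hB
  exact ⟨y, hy, hUs hyU⟩

/-- Local compactness gives a compact neighbourhood of `x` inside the complement of `A`, and missing
a compact set is an open condition. -/
theorem eventually_miss [T2Space X] [LocallyCompactSpace X] {A : ClosedSubsets X} {x : X}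
    (hx : x ∉ A.carrier) : ∃ K ∈ 𝓝 x, ∀ᶠ B : ClosedSubsets X in 𝓝 A, ∀ y ∈ B.carrier, y ∉ K := by
  obtain ⟨K, hK, hKA, hKc⟩ := local_compact_nhds (A.isClosed_carrier.isOpen_compl.mem_nhds hx)
  refine ⟨K, hK, ?_⟩
  have hA : A.carrier ∩ K = ∅ := by
    rw [← disjoint_iff_inter_eq_empty]
    exact (disjoint_left.2 fun y hy hyA => hKA hy hyA).symm
  filter_upwards [(isOpen_miss hKc).mem_nhds (show A ∈ _ from hA)] with B hB y hy hyK
  exact (hB ▸ (⟨hy, hyK⟩ : y ∈ B.carrier ∩ K) : y ∈ (∅ : Set X))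

theorem isClosed_mem [T2Space X] [LocallyCompactSpace X] :
    IsClosed {z : X × ClosedSubsets X | z.1 ∈ z.2.carrier} := by
  rw [← isOpen_compl_iff, isOpen_iff_mem_nhds]
  rintro ⟨x, A⟩ hx
  obtain ⟨K, hK, hA⟩ := eventually_miss (A := A) (x := x) hx
  rw [nhds_prod_eq]
  filter_upwards [prod_mem_prod hK hA] with z hz hmem
  exact hz.2 _ hmem hz.1

theorem isClosed_subset [T2Space X] [LocallyCompactSpace X] :
    IsClosed {z : ClosedSubsets X × ClosedSubsets X | z.1.carrier ⊆ z.2.carrier} := by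
  rw [← isOpen_compl_iff, isOpen_iff_mem_nhds]
  rintro ⟨A, B⟩ hAB
  obtain ⟨x, hxA, hxB⟩ := not_subset.1 hAB
  obtain ⟨K, hK, hB⟩ := eventually_miss hxB
  rw [nhds_prod_eq]
  filter_upwards [prod_mem_prod (eventually_hit hxA hK) hB] with z hz hsub
  obtain ⟨y, hy, hyK⟩ := hz.1
  exact hz.2 y (hsub hy) hyK

instance [T2Space X] [LocallyCompactSpace X] : T2Space (ClosedSubsets X) := by
  rw [t2_iff_isClosed_diagonal]
  have : diagonal (ClosedSubsets X) = {z | z.1.carrier ⊆ z.2.carrier} ∩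
      Prod.swap ⁻¹' {z : ClosedSubsets X × ClosedSubsets X | z.1.carrier ⊆ z.2.carrier} := by
    ext ⟨A, B⟩
    constructor
    · rintro h
      obtain rfl : A = B := h
      exact ⟨subset_refl A.carrier, subset_refl A.carrier⟩
    · rintro ⟨h₁, h₂⟩
      exact ext_carrier (subset_antisymm h₁ h₂)
  rw [this]
  exact isClosed_subset.inter (isClosed_subset.preimage continuous_swap)

/-- The distance to a closed set depends continuously on the closed set. -/
theorem continuousAt_infDist {X : Type*} [PseudoMetricSpace X] [ProperSpace X] [T2Space X]
    (A : ClosedSubsets X) (hA : A.carrier.Nonempty) (x : X) :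
    ContinuousAt (fun z : ClosedSubsets X × X => Metric.infDist z.2 z.1.carrier) (A, x) := by
  have key : Tendsto (fun B : ClosedSubsets X => Metric.infDist x B.carrier) (𝓝 A)
      (𝓝 (Metric.infDist x A.carrier)) := by
    rw [tendsto_order]
    constructor
    · intro r hr
      rcases lt_or_ge r 0 with hr0 | hr0
      · exact Eventually.of_forall fun B => hr0.trans_le Metric.infDist_nonneg
      obtain ⟨r', hrr', hr'⟩ := exists_between hr
      -- Lower bound: `A` misses a closed ball, which is compact, so nearby sets miss it too.
      have hmiss : A.carrier ∩ Metric.closedBall x r' = ∅ := by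
        ext y
        simp only [mem_inter_iff, Metric.mem_closedBall, mem_empty_iff_false, iff_false, not_and,
          not_le]
        intro hy
        rw [dist_comm]
        exact hr'.trans_le (Metric.infDist_le_dist_of_mem hy)
      -- `infDist` to the empty set is `0`, so nearby sets must also be known to be non-empty.
      obtain ⟨y₀, hy₀⟩ := hA
      filter_upwards [(isOpen_miss (isCompact_closedBall x r')).mem_nhds (show A ∈ _ from hmiss),
        eventually_hit hy₀ univ_mem] with B hB hne
      obtain ⟨y, hy, -⟩ := hne
      refine hrr'.trans_le ((Metric.le_infDist ⟨y, hy⟩).2 fun z hz => ?_)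
      by_contra! h
      rw [dist_comm] at h
      exact (hB ▸ (⟨hz, h.le⟩ : z ∈ B.carrier ∩ Metric.closedBall x r') : z ∈ (∅ : Set X))
    -- Upper bound: nearby sets still hit the open ball of radius `r`.
    · intro r hr
      obtain ⟨y, hy, hyr⟩ := (Metric.infDist_lt_iff hA).1 hr
      rw [dist_comm] at hyr
      filter_upwards [eventually_hit hy (Metric.isOpen_ball.mem_nhds hyr)] with B hB
      obtain ⟨z, hz, hzr⟩ := hB
      refine (Metric.infDist_le_dist_of_mem hz).trans_lt ?_
      rw [dist_comm]
      exact hzr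
  rw [Metric.continuousAt_iff']
  intro ε hε
  rw [nhds_prod_eq]
  filter_upwards [prod_mem_prod (Metric.tendsto_nhds.1 key (ε / 2) (half_pos hε))
    (Metric.ball_mem_nhds x (half_pos hε))] with z hz
  obtain ⟨h₁, h₂⟩ := hz
  -- The distance is 1-Lipschitz in the point for every closed set, so continuity in the set at the
  -- fixed point `x` suffices.
  have h₃ : dist (Metric.infDist z.2 z.1.carrier) (Metric.infDist x z.1.carrier) ≤ dist z.2 x := by
    simpa using (Metric.lipschitz_infDist_pt z.1.carrier).dist_le_mul z.2 x
  have h₁' : dist (Metric.infDist x z.1.carrier) (Metric.infDist x A.carrier) < ε / 2 := h₁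
  have h₂' : dist z.2 x < ε / 2 := h₂
  linarith [dist_triangle (Metric.infDist z.2 z.1.carrier) (Metric.infDist x z.1.carrier)
    (Metric.infDist x A.carrier)]

end ClosedSubsets

/-- A closed-graph criterion: a locally bounded choice of points in a closed relation is continuous
wherever the relation is single-valued. -/
theorem continuousAt_of_isClosed_relation {A B : Type*} [TopologicalSpace A] [TopologicalSpace B]
    {f : A → B} {R : Set (A × B)} (hR : IsClosed R) {a₀ : A} {K : Set B} (hK : IsCompact K)
    (hfK : ∀ᶠ a in nhds a₀, f a ∈ K) (hf : ∀ a, (a, f a) ∈ R)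
    (huniq : ∀ b, (a₀, b) ∈ R → b = f a₀) : ContinuousAt f a₀ := by
  refine hK.tendsto_nhds_of_unique_mapClusterPt hfK fun b _ hb => huniq b ?_
  refine hR.mem_of_mapClusterPt (f := fun a => (a, f a)) (b := nhds a₀) ?_
    (Filter.Eventually.of_forall hf)
  rw [mapClusterPt_iff_ultrafilter] at hb ⊢
  obtain ⟨U, hU, hUb⟩ := hb
  exact ⟨U, hU, by rw [nhds_prod_eq]; exact (Filter.tendsto_id'.2 hU).prodMk hUb⟩

/-! ### Faces of a closed convex cone, their dimensions, and the relative dual ray. -/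

namespace ConeFace

open Topology Filter Set
open scoped RealInnerProductSpace

variable {X : Type*} [NormedAddCommGroup X] [InnerProductSpace ℝ X]

/-! ### Relative interiors -/

/-- As `0 ∈ F`, the direction of the affine span contains the linear span, so the line through `x`
along `v` stays in the affine span, in which `x` is an interior point. -/
theorem exists_pos_sub_smul_mem {F : Set X} (h0 : (0 : X) ∈ F) {x v : X}
    (hx : x ∈ intrinsicInterior ℝ F) (hv : v ∈ Submodule.span ℝ F) :
    ∃ ε : ℝ, 0 < ε ∧ x - ε • v ∈ F := by
  obtain ⟨y, hy, rfl⟩ := mem_intrinsicInterior.1 hx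
  have hdir : v ∈ (affineSpan ℝ F).direction := by
    rw [direction_affineSpan]
    refine Submodule.span_le.2 (fun z hz => ?_) hv
    simpa using vsub_mem_vectorSpan ℝ hz h0
  have hmem : ∀ t : ℝ, (y : X) - t • v ∈ affineSpan ℝ F := fun t => by
    have := AffineSubspace.vadd_mem_of_mem_direction
      (Submodule.smul_mem _ (-t) hdir) y.2
    simpa [sub_eq_add_neg, add_comm] using this
  have hcont : Continuous fun t : ℝ => (⟨(y : X) - t • v, hmem t⟩ : affineSpan ℝ F) :=
    Continuous.subtype_mk (by fun_prop) _
  have hev : ∀ᶠ t in 𝓝 (0 : ℝ), (⟨(y : X) - t • v, hmem t⟩ : affineSpan ℝ F) ∈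
      ((↑) ⁻¹' F : Set (affineSpan ℝ F)) := by
    refine hcont.continuousAt.eventually_mem ?_
    have h : (⟨(y : X) - (0 : ℝ) • v, hmem 0⟩ : affineSpan ℝ F) = y := by
      ext; simp
    rw [h]
    exact mem_interior_iff_mem_nhds.1 hy
  obtain ⟨ε, h₁, h₂⟩ := ((hev.filter_mono nhdsWithin_le_nhds).and
    (self_mem_nhdsWithin (a := (0 : ℝ)) (s := Ioi 0))).exists
  exact ⟨ε, h₂, h₁⟩

/-- A segment from `z` prolonged beyond `x` has `x` in its interior: `(1 + ε) x = ε z + (x - ε (z -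
x))`. This feeds the extremality of faces. -/
theorem mem_openSegment_sub_smul {x z : X} {ε : ℝ} (hε : 0 < ε) :
    x ∈ openSegment ℝ z (x - ε • (z - x)) := by
  have h : 0 < 1 + ε := by positivity
  refine ⟨ε / (1 + ε), 1 / (1 + ε), by positivity, by positivity, by field_simp; ring, ?_⟩
  rw [← sub_eq_zero]
  have : (ε / (1 + ε)) • z + (1 / (1 + ε)) • (x - ε • (z - x)) - x =
      (ε / (1 + ε) - 1 / (1 + ε) * ε) • z + (1 / (1 + ε) + 1 / (1 + ε) * ε - 1) • x := by
    module
  rw [this, show ε / (1 + ε) - 1 / (1 + ε) * ε = 0 by field_simp; ring,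
    show 1 / (1 + ε) + 1 / (1 + ε) * ε - 1 = 0 by field_simp; ring]
  simp

/-- A functional which is non-negative on `F` and vanishes at a relative interior point vanishes
on `F`. -/
theorem mem_orthogonal_span_of_intrinsicInterior {F : Set X} (h0 : (0 : X) ∈ F) {x ν : X}
    (hx : x ∈ intrinsicInterior ℝ F) (hν : ∀ y ∈ F, 0 ≤ ⟪y, ν⟫) (hxν : ⟪x, ν⟫ = 0) :
    ν ∈ (Submodule.span ℝ F)ᗮ := by
  rw [Submodule.mem_orthogonal]
  intro v hv
  have key : ∀ v ∈ Submodule.span ℝ F, ⟪v, ν⟫ ≤ 0 := fun v hv => by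
    obtain ⟨ε, hε, hmem⟩ := exists_pos_sub_smul_mem h0 hx hv
    have := hν _ hmem
    rw [inner_sub_left, real_inner_smul_left, hxν] at this
    by_contra! h
    nlinarith
  refine le_antisymm (key v hv) ?_
  have := key (-v) (Submodule.neg_mem _ hv)
  rw [inner_neg_left] at this
  linarith

/-! ### Faces of a closed convex cone -/

section Faces

variable {C : ProperCone ℝ X} {E F G : Set X}

theorem smul_mem_cone {x : X} (hx : x ∈ (C : Set X)) {t : ℝ} (ht : 0 ≤ t) :
    t • x ∈ (C : Set X) :=
  C.toSubmodule.smul_mem (⟨t, ht⟩ : NNReal) hx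

theorem zero_mem_cone : (0 : X) ∈ (C : Set X) := C.toSubmodule.zero_mem

theorem add_mem_cone {x y : X} (hx : x ∈ (C : Set X)) (hy : y ∈ (C : Set X)) :
    x + y ∈ (C : Set X) := C.toSubmodule.add_mem hx hy

theorem convex_cone : Convex ℝ (C : Set X) := fun _ hx _ hy _ _ ha hb _ =>
  add_mem_cone (smul_mem_cone hx ha) (smul_mem_cone hy hb)

theorem isFace_self : IsFace (C : Set X) C :=
  ⟨⟨0, zero_mem_cone⟩, convex_cone, IsExtreme.refl ℝ _⟩

theorem IsFace.zero_mem (hF : IsFace (C : Set X) F) : (0 : X) ∈ F := by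
  obtain ⟨z, hz⟩ := hF.nonempty
  -- `z` is the midpoint of `0` and `2z`.
  refine hF.extreme.left_mem_of_mem_openSegment zero_mem_cone
    (smul_mem_cone (hF.extreme.subset hz) (zero_le_two (α := ℝ))) hz ?_
  exact ⟨1 / 2, 1 / 2, by norm_num, by norm_num, by norm_num, by simp [smul_smul]⟩

theorem IsFace.smul_mem (hF : IsFace (C : Set X) F) {z : X} (hz : z ∈ F) {t : ℝ} (ht : 0 ≤ t) :
    t • z ∈ F := by
  rcases le_or_gt t 1 with h1 | h1
  · have := hF.convex hF.zero_mem hz (sub_nonneg.2 h1) ht (by ring)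
    simpa using this
  -- For `t > 1`, `z` lies strictly between `0` and `t z`.
  · refine hF.extreme.right_mem_of_mem_openSegment zero_mem_cone
      (smul_mem_cone (hF.extreme.subset hz) ht) hz ?_
    have h0 : 0 < t := by linarith
    refine ⟨1 - 1 / t, 1 / t, ?_, by positivity, by ring, ?_⟩
    · rw [sub_pos, div_lt_one h0]; exact h1
    · rw [smul_zero, zero_add, smul_smul, one_div, inv_mul_cancel₀ h0.ne', one_smul]

theorem IsFace.add_mem (hF : IsFace (C : Set X) F) {x y : X} (hx : x ∈ F) (hy : y ∈ F) :
    x + y ∈ F := by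
  have := hF.smul_mem (hF.convex hx hy (by norm_num) (by norm_num)
    (show (1 / 2 : ℝ) + 1 / 2 = 1 by norm_num)) (zero_le_two (α := ℝ))
  simpa [smul_smul] using this

/-- A face which contains a relative interior point of a convex subset contains this subset. -/
theorem IsFace.subset_of_mem_intrinsicInterior (hG : IsFace (C : Set X) G)
    (hF : IsFace (C : Set X) F) {x : X} (hx : x ∈ intrinsicInterior ℝ F) (hxG : x ∈ G) :
    F ⊆ G := by
  intro z hz
  obtain ⟨ε, hε, hmem⟩ := exists_pos_sub_smul_mem hF.zero_mem hx
    (Submodule.sub_mem _ (Submodule.subset_span hz)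
      (Submodule.subset_span (intrinsicInterior_subset hx)))
  exact hG.extreme.left_mem_of_mem_openSegment (hF.extreme.subset hz) (hF.extreme.subset hmem) hxG
    (mem_openSegment_sub_smul hε)

/-- The subset of `E` where a functional in the dual cone of `E` vanishes is a face. -/
theorem IsFace.inter_orthogonal (hE : IsFace (C : Set X) E) {f : X} (hf : ∀ y ∈ E, 0 ≤ ⟪y, f⟫) :
    IsFace (C : Set X) (E ∩ {y | ⟪y, f⟫ = 0}) := by
  refine ⟨⟨0, hE.zero_mem, inner_zero_left _⟩, ?_, hE.extreme.trans ⟨inter_subset_left, ?_⟩⟩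
  · refine hE.convex.inter fun x hx y hy a b _ _ _ => ?_
    simp only [mem_ofPred_eq] at hx hy ⊢
    rw [inner_add_left, real_inner_smul_left, real_inner_smul_left, hx, hy]
    simp
  · rintro x hx y hy z ⟨-, hz⟩ ⟨a, b, ha, hb, -, rfl⟩
    refine ⟨hx, ?_⟩
    simp only [mem_ofPred_eq, inner_add_left, real_inner_smul_left] at hz ⊢
    have h₁ := hf x hx
    have h₂ := mul_nonneg hb.le (hf y hy)
    by_contra h
    have h₃ := mul_pos ha (lt_of_le_of_ne h₁ (Ne.symm h))
    linarith

variable [FiniteDimensional ℝ X]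

theorem IsFace.exists_mem_intrinsicInterior (hF : IsFace (C : Set X) F) :
    ∃ x, x ∈ intrinsicInterior ℝ F :=
  Set.Nonempty.intrinsicInterior hF.convex hF.nonempty

theorem dim_mono (h : F ⊆ G) : dim F ≤ dim G :=
  Submodule.finrank_mono (Submodule.span_mono h)

/-- The spans agree, so the segment from any `z ∈ G` to a relative interior point of `F` can be
prolonged inside `F`; extremality of `F` then gives `z ∈ F`. -/
theorem IsFace.eq_of_subset_of_dim_le (hF : IsFace (C : Set X) F) (hG : IsFace (C : Set X) G)
    (h : F ⊆ G) (hd : dim G ≤ dim F) : F = G := by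
  have hspan := Submodule.eq_of_le_of_finrank_le (Submodule.span_mono (R := ℝ) h) hd
  obtain ⟨x, hx⟩ := hF.exists_mem_intrinsicInterior
  refine subset_antisymm h fun z hz => ?_
  have hzs : z ∈ Submodule.span ℝ F := hspan ▸ Submodule.subset_span hz
  obtain ⟨ε, hε, hmem⟩ := exists_pos_sub_smul_mem hF.zero_mem hx
    (Submodule.sub_mem _ hzs (Submodule.subset_span (intrinsicInterior_subset hx)))
  exact hF.extreme.left_mem_of_mem_openSegment (hG.extreme.subset hz) (hF.extreme.subset hmem)
    (intrinsicInterior_subset hx) (mem_openSegment_sub_smul hε)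

/-- If the spans were equal, `f` would lie in the span of vectors orthogonal to `f`. -/
theorem dim_inter_orthogonal_lt {f : X} (hf : f ∈ Submodule.span ℝ E) (hf0 : f ≠ 0) :
    dim (E ∩ {y | ⟪y, f⟫ = 0}) < dim E := by
  refine Submodule.finrank_lt_finrank_of_lt (lt_of_le_of_ne (Submodule.span_mono inter_subset_left)
    fun h => hf0 ?_)
  have hle : Submodule.span ℝ (E ∩ {y | ⟪y, f⟫ = 0}) ≤ (Submodule.span ℝ {f})ᗮ := by
    rw [Submodule.span_le]
    rintro y ⟨-, hy⟩
    rw [SetLike.mem_coe, Submodule.mem_orthogonal_singleton_iff_inner_left]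
    exact hy
  have := hle (h ▸ hf)
  rw [Submodule.mem_orthogonal_singleton_iff_inner_left] at this
  exact inner_self_eq_zero.1 this

/-! ### Dimensions of faces -/

theorem finite_faceDims (C : Set X) : (faceDims C).Finite := by
  refine (finite_Iic (Module.finrank ℝ X)).subset ?_
  rintro m ⟨F, -, rfl⟩
  exact Submodule.finrank_le _

/-- The subtraction in `depth` does not truncate, because `C` is a face of itself. -/
theorem card_faceDims (C : ProperCone ℝ X) :
    (finite_faceDims (C : Set X)).toFinset.card = depth (C : Set X) + 1 := by
  have hne : (faceDims (C : Set X)).Nonempty := ⟨_, _, isFace_self, rfl⟩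
  have hpos : 0 < (faceDims (C : Set X)).ncard := (ncard_pos (finite_faceDims _)).2 hne
  rw [← ncard_eq_toFinset_card _ (finite_faceDims _), depth]
  omega

theorem faceDim_lt {i i' : ℕ} (h : i < i') (h' : i' ≤ depth (C : Set X)) :
    faceDim (C : Set X) i < faceDim (C : Set X) i' :=
  Nat.nth_lt_nth_of_lt_card (finite_faceDims (C : Set X)) h
    (by have := card_faceDims C; exact lt_of_lt_of_eq (Nat.lt_succ_of_le h') this.symm)

theorem exists_faceDim_eq {m : ℕ} (hm : m ∈ faceDims (C : Set X)) :
    ∃ i ≤ depth (C : Set X), faceDim (C : Set X) i = m := by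
  obtain ⟨i, hi, h⟩ := Nat.exists_lt_card_finite_nth_eq
    (p := fun m => m ∈ faceDims (C : Set X)) (finite_faceDims (C : Set X)) hm
  exact ⟨i, Nat.lt_succ_iff.1 (lt_of_lt_of_eq hi (card_faceDims C)), h⟩

variable {j : ℕ}

theorem faceDim_sub_lt (hj : 1 ≤ j) (hjd : j ≤ depth (C : Set X)) :
    faceDim (C : Set X) (depth (C : Set X) - j) <
      faceDim (C : Set X) (depth (C : Set X) - (j - 1)) :=
  faceDim_lt (by omega) (by omega)

/-- The indexing reverses dimension: faces of dimension below `n_{d-j+1}` are those in some `P_l`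
with `l ≥ j`. -/
theorem exists_mem_facesAt (hj : 1 ≤ j) {G : ClosedSubsets X}
    (hG : IsFace (C : Set X) G.carrier)
    (h : dim G.carrier < faceDim (C : Set X) (depth (C : Set X) - (j - 1))) :
    ∃ l, j ≤ l ∧ l ≤ depth (C : Set X) ∧ G ∈ facesAt (C : Set X) l := by
  obtain ⟨i, hi, him⟩ := exists_faceDim_eq (C := C) ⟨_, hG, rfl⟩
  refine ⟨depth (C : Set X) - i, ?_, by omega, hG, ?_⟩
  · by_contra! hlt
    have : depth (C : Set X) - (j - 1) ≤ i := by omega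
    rcases this.eq_or_lt with h' | h'
    · rw [h', him] at h; exact lt_irrefl _ h
    · have := faceDim_lt h' hi
      omega
  · rw [← him]; congr 1; omega

/-- No face has a dimension strictly between `n_{d-j}` and `n_{d-j+1}`. -/
theorem dim_le_of_dim_lt (hj : 1 ≤ j) {G : ClosedSubsets X}
    (hG : IsFace (C : Set X) G.carrier)
    (h : dim G.carrier < faceDim (C : Set X) (depth (C : Set X) - (j - 1))) :
    dim G.carrier ≤ faceDim (C : Set X) (depth (C : Set X) - j) := by
  obtain ⟨l, hjl, hld, -, hl⟩ := exists_mem_facesAt hj hG h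
  rw [hl]
  rcases hjl.eq_or_lt with rfl | h'
  · rfl
  · exact (faceDim_lt (by omega) (by omega)).le

/-! ### The normalised generator of the relative dual face -/

theorem mem_relDual {f : X} :
    f ∈ relDual E ↔ (∀ y ∈ E, 0 ≤ ⟪y, f⟫) ∧ f ∈ Submodule.span ℝ E := by
  simp only [relDual, mem_inter_iff, SetLike.mem_coe, ProperCone.mem_innerDual]

theorem mem_relDualFace {f : X} : f ∈ relDualFace E F ↔
    f ∈ (Submodule.span ℝ F)ᗮ ∧ (∀ y ∈ E, 0 ≤ ⟪y, f⟫) ∧ f ∈ Submodule.span ℝ E := by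
  rw [relDualFace, mem_inter_iff, mem_relDual, SetLike.mem_coe]

/-- Every non-zero element of the relative dual face cuts out a supporting hyperplane at `x`.
Uniqueness of the hyperplane makes two such elements proportional, and positivity on `E` fixes the
sign. -/
theorem IsRegularPoint.exists_isNormalisedGenerator (hF : IsFace (C : Set X) F) (hFE : F ⊆ E)
    {x : X} (hx : x ∈ intrinsicInterior ℝ F) (hreg : IsRegularPoint E x) :
    ∃ e, IsNormalisedGenerator E F e := by
  obtain ⟨H, ⟨ν, hν, hν0, hνx, rfl⟩, huniq⟩ := hreg
  have hνE := mem_relDual.1 hν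
  have hνn : 0 < ‖ν‖ := norm_pos_iff.2 hν0
  have hνF : ν ∈ (Submodule.span ℝ F)ᗮ := mem_orthogonal_span_of_intrinsicInterior hF.zero_mem hx
    (fun y hy => hνE.1 y (hFE hy)) (by rw [real_inner_comm]; exact hνx)
  refine ⟨‖ν‖⁻¹ • ν, by rw [norm_smul, norm_inv, norm_norm, inv_mul_cancel₀ hνn.ne'], ?_⟩
  ext z
  rw [mem_relDualFace, mem_ofPred_eq]
  constructor
  · rintro ⟨hzF, hzE, hzs⟩
    rcases eq_or_ne z 0 with rfl | hz0
    · exact ⟨0, le_rfl, by simp⟩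
    have hH := huniq _ ⟨z, mem_relDual.2 ⟨hzE, hzs⟩, hz0,
      by rw [real_inner_comm]; exact hzF _ (Submodule.subset_span (intrinsicInterior_subset hx)),
        rfl⟩
    -- `c • ν` is the component of `z` along `ν`. The remainder lies in the hyperplane of `ν`, which
    -- is also that of `z`; being orthogonal to both, it vanishes.
    set c : ℝ := ⟪ν, z⟫ / ⟪ν, ν⟫ with hc
    have hνν : ⟪ν, ν⟫ ≠ 0 := by simpa using hν0
    have hu : z - c • ν ∈ Submodule.span ℝ E ⊓ (Submodule.span ℝ {ν})ᗮ := by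
      refine ⟨Submodule.sub_mem _ hzs (Submodule.smul_mem _ _ hνE.2), ?_⟩
      rw [SetLike.mem_coe, Submodule.mem_orthogonal_singleton_iff_inner_right, inner_sub_right,
        real_inner_smul_right, hc]
      field_simp
      ring
    have hu' := hu
    rw [← hH] at hu'
    have h₁ := (Submodule.mem_orthogonal_singleton_iff_inner_right).1 hu.2
    have h₂ := (Submodule.mem_orthogonal_singleton_iff_inner_right).1 hu'.2
    have hz : z = c • ν := by
      rw [← sub_eq_zero, ← inner_self_eq_zero (𝕜 := ℝ)]
      nth_rw 1 [inner_sub_left]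
      rw [real_inner_smul_left, h₁, h₂]
      simp
    have hc0 : 0 ≤ c := by
      -- If `c < 0`, then `ν` and `-ν` are both non-negative on `E`, so `ν` is orthogonal to its own
      -- span `⟨E⟩`.
      by_contra! hneg
      have hν' : ν ∈ (Submodule.span ℝ E)ᗮ := by
        rw [Submodule.mem_orthogonal]
        intro u hu
        induction hu using Submodule.span_induction with
        | mem y hy =>
          have h₃ := hνE.1 y hy
          have h₄ := hzE y hy
          rw [hz, real_inner_smul_right] at h₄
          nlinarith
        | zero => exact inner_zero_left _
        | add a b _ _ ha hb => rw [inner_add_left, ha, hb, add_zero]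
        | smul t a _ ha => rw [real_inner_smul_left, ha, mul_zero]
      exact hν0 (inner_self_eq_zero.1 (hν' ν hνE.2))
    refine ⟨c * ‖ν‖, by positivity, ?_⟩
    rw [smul_smul, mul_assoc, mul_inv_cancel₀ hνn.ne', mul_one]
    exact hz
  · rintro ⟨t, ht, rfl⟩
    rw [smul_smul]
    have hs : 0 ≤ t * ‖ν‖⁻¹ := by positivity
    refine ⟨Submodule.smul_mem _ _ hνF, fun y hy => ?_, Submodule.smul_mem _ _ hνE.2⟩
    rw [real_inner_smul_right]
    exact mul_nonneg hs (hνE.1 y hy)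

theorem IsNormalisedGenerator.mem {e : X} (he : IsNormalisedGenerator E F e) :
    e ∈ relDualFace E F := by
  rw [he.2]
  exact ⟨1, zero_le_one, by simp⟩

theorem IsNormalisedGenerator.eq_smul {e f : X} (he : IsNormalisedGenerator E F e)
    (hf : f ∈ relDualFace E F) : f = ‖f‖ • e := by
  rw [he.2] at hf
  obtain ⟨t, ht, rfl⟩ := hf
  rw [norm_smul, he.1, Real.norm_of_nonneg ht, mul_one]

theorem exists_isNormalisedGenerator (hsmooth : LocallySmooth (C : Set X)) (hj : 1 ≤ j)
    (hjd : j ≤ depth (C : Set X)) {E F : ClosedSubsets X}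
    (hE : E ∈ facesAt (C : Set X) (j - 1)) (hF : F ∈ facesAt (C : Set X) j)
    (hFE : F.carrier ⊆ E.carrier) : ∃ e, IsNormalisedGenerator E.carrier F.carrier e := by
  obtain ⟨x, hx⟩ := hF.1.exists_mem_intrinsicInterior
  have hlt := faceDim_sub_lt hj hjd
  have hmax : IsMaxDimIn (C : Set X) E.carrier F.carrier := by
    refine ⟨hF.1, hFE, ⟨⟨_, hF.1, rfl⟩, ?_⟩, ?_⟩
    · rw [hE.2, hF.2]; exact hlt
    -- `n_{d-j}` immediately precedes `n_{d-j+1}` among the face dimensions.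
    · rintro m ⟨hm, hmE⟩
      obtain ⟨i, hi, rfl⟩ := exists_faceDim_eq hm
      rw [hE.2] at hmE
      rw [hF.2]
      by_contra! h
      rcases lt_trichotomy i (depth (C : Set X) - j) with h' | h' | h'
      · have := faceDim_lt (C := C) h' (by omega)
        omega
      · rw [h'] at h; exact lt_irrefl _ h
      · have h'' : depth (C : Set X) - (j - 1) ≤ i := by omega
        rcases h''.eq_or_lt with h3 | h3
        · rw [h3] at hmE; exact lt_irrefl _ hmE
        · have := faceDim_lt h3 hi
          omega
  have hne : F.carrier ≠ E.carrier := fun h => by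
    have := hF.2
    rw [h, hE.2] at this
    omega
  exact (hsmooth _ ⟨hE.1, _, hmax⟩ _ hmax hne x hx).exists_isNormalisedGenerator hF.1 hFE hx

end Faces

end ConeFace

/-! ### Continuity of spans, generators and half-spaces over the space of flags. -/

namespace ConeFace

open Topology Filter Set
open scoped RealInnerProductSpace

variable {X : Type*} [NormedAddCommGroup X] [InnerProductSpace ℝ X]

/-! ### Continuity of linear spans -/

/-- A point of `A` violating the condition is approximated by points of nearby sets, which violate
it as well. -/
theorem isClosed_forall_inner_mem {T : Set ℝ} (hT : IsClosed T) :
    IsClosed {z : ClosedSubsets X × X | ∀ x ∈ z.1.carrier, ⟪x, z.2⟫ ∈ T} := by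
  rw [← isOpen_compl_iff, isOpen_iff_mem_nhds]
  rintro ⟨A, u⟩ h
  simp only [mem_compl_iff, mem_ofPred_eq, not_forall] at h
  obtain ⟨x, hx, hxT⟩ := h
  have hcont : ContinuousAt (fun z : X × X => ⟪z.1, z.2⟫) (x, u) := by fun_prop
  have hnear := hcont.eventually_mem (hT.isOpen_compl.mem_nhds hxT)
  rw [nhds_prod_eq, eventually_prod_iff] at hnear
  obtain ⟨pa, ha, pb, hb, hab⟩ := hnear
  rw [nhds_prod_eq]
  filter_upwards [prod_mem_prod (ClosedSubsets.eventually_hit hx ha) hb] with z hz hmem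
  obtain ⟨⟨y, hy, hya⟩, hzb⟩ := hz
  exact hab hya hzb (hmem y hy)

/-- The space of the closed sets whose linear span has dimension `n`. -/
abbrev OfDim (X : Type*) [NormedAddCommGroup X] [InnerProductSpace ℝ X] (n : ℕ) : Type _ :=
  {A : ClosedSubsets X // dim A.carrier = n}

/-! ### The space of flags -/

section Flags

variable {C : ProperCone ℝ X} {j : ℕ}

theorem isFace_top (q : flags (C : Set X) j) : IsFace (C : Set X) q.1.1.carrier := q.2.1.1

theorem isFace_bot (q : flags (C : Set X) j) : IsFace (C : Set X) q.1.2.carrier := q.2.2.1.1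

theorem exists_flag (y : flagBase (C : Set X) j) :
    ∃ q : flags (C : Set X) j, flagProj (C : Set X) j q = y := by
  obtain ⟨_, q, hq, rfl⟩ := y
  exact ⟨⟨q, hq⟩, rfl⟩

theorem flagBase_isFace (y : flagBase (C : Set X) j) : IsFace (C : Set X) y.1.carrier := by
  obtain ⟨q, rfl⟩ := exists_flag y
  exact isFace_top q

theorem flagBase_dim (y : flagBase (C : Set X) j) :
    dim y.1.carrier = faceDim (C : Set X) (depth (C : Set X) - (j - 1)) := by
  obtain ⟨q, rfl⟩ := exists_flag y
  exact q.2.1.2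

theorem continuous_flagProj : Continuous (flagProj (C : Set X) j) :=
  Continuous.subtype_mk (by fun_prop) _

/-- The larger face of a flag, in the space of the closed sets of the given dimension. -/
def topFace (y : flagBase (C : Set X) j) :
    OfDim X (faceDim (C : Set X) (depth (C : Set X) - (j - 1))) := ⟨y.1, flagBase_dim y⟩

/-- The smaller face of a flag, in the space of the closed sets of the given dimension. -/
def botFace (q : flags (C : Set X) j) :
    OfDim X (faceDim (C : Set X) (depth (C : Set X) - j)) := ⟨q.1.2, q.2.2.1.2⟩

theorem continuous_topFace : Continuous (topFace (C := C) (j := j)) :=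
  Continuous.subtype_mk continuous_subtype_val _

theorem continuous_botFace : Continuous (botFace (C := C) (j := j)) :=
  Continuous.subtype_mk (by fun_prop) _

end Flags

variable [FiniteDimensional ℝ X] {n : ℕ}

/-- Linear independence is open: if `v` is independent of a basis of `⟨A⟩` chosen in `A`, then
nearby `v'` are independent of nearby points of `B`. Since the dimension is fixed, those points
still span `⟨B⟩`. -/
theorem isClosed_mem_span :
    IsClosed {z : OfDim X n × X | z.2 ∈ Submodule.span ℝ z.1.1.carrier} := by
  rw [← isOpen_compl_iff, isOpen_iff_mem_nhds]
  rintro ⟨⟨A, rfl⟩, v⟩ (hv : v ∉ Submodule.span ℝ A.carrier)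
  obtain ⟨b, hb, hspan, hli⟩ : ∃ b : Fin (dim A.carrier) → X, (∀ i, b i ∈ A.carrier) ∧
      Submodule.span ℝ (range b) = Submodule.span ℝ A.carrier ∧ LinearIndependent ℝ b :=
    Submodule.exists_fun_fin_finrank_span_eq ℝ A.carrier
  have hli' : LinearIndependent ℝ (Fin.cons v b : Fin (dim A.carrier + 1) → X) :=
    linearIndependent_finCons.2 ⟨hli, by rwa [hspan]⟩
  have hnear := (isOpen_setOfPred_linearIndependent (𝕜 := ℝ)).mem_nhds hli'
  have hcons : ContinuousAt (fun z : X × (Fin (dim A.carrier) → X) =>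
      (Fin.cons z.1 z.2 : Fin (dim A.carrier + 1) → X)) (v, b) :=
    (continuous_fst.finCons continuous_snd).continuousAt
  have hnear' := hcons.eventually_mem hnear
  rw [nhds_prod_eq, eventually_prod_iff] at hnear'
  obtain ⟨pa, ha, pb, hpb, hab⟩ := hnear'
  rw [nhds_pi, eventually_iff, Filter.mem_pi] at hpb
  obtain ⟨I, -, t, ht, hsub⟩ := hpb
  have hE : ∀ᶠ B : OfDim X (dim A.carrier) in 𝓝 ⟨A, rfl⟩,
      ∀ i, ∃ y ∈ B.1.carrier, y ∈ t i := by
    rw [eventually_all]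
    exact fun i => (continuous_subtype_val.tendsto
      (⟨A, rfl⟩ : OfDim X (dim A.carrier))).eventually (ClosedSubsets.eventually_hit (hb i) (ht i))
  rw [nhds_prod_eq]
  filter_upwards [prod_mem_prod hE ha] with z hz hmem
  obtain ⟨h₁, h₂⟩ := hz
  choose y hyB hyt using h₁
  have hli'' := hab h₂ (hsub fun i _ => hyt i)
  obtain ⟨hy, hz⟩ := linearIndependent_finCons.1 hli''
  refine hz ?_
  have hle : Submodule.span ℝ (range y) ≤ Submodule.span ℝ z.1.1.carrier :=
    Submodule.span_mono (range_subset_iff.2 hyB)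
  rw [Submodule.eq_of_le_of_finrank_eq hle]
  · exact hmem
  · rw [finrank_span_eq_card hy, Fintype.card_fin]
    exact z.1.2.symm

/-- The projection is characterised by two closed conditions, membership in the span and
orthogonality of the remainder, and it is locally bounded; the closed-graph criterion applies. -/
theorem continuous_starProjection_span : Continuous fun z : OfDim X n × X =>
    (Submodule.span ℝ z.1.1.carrier).starProjection z.2 := by
  rw [continuous_iff_continuousAt]
  rintro ⟨A, v⟩
  refine continuousAt_of_isClosed_relation
    (R := {w : (OfDim X n × X) × X | w.2 ∈ Submodule.span ℝ w.1.1.1.carrier} ∩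
      {w | ∀ x ∈ w.1.1.1.carrier, ⟪x, w.1.2 - w.2⟫ ∈ ({0} : Set ℝ)}) ?_
    (isCompact_closedBall (0 : X) (‖v‖ + 1)) ?_ ?_ ?_
  · refine IsClosed.inter ?_ ?_
    · exact isClosed_mem_span.preimage
        (f := fun w : (OfDim X n × X) × X => ((w.1.1, w.2) : OfDim X n × X)) (by fun_prop)
    · exact (isClosed_forall_inner_mem (X := X) isClosed_singleton).preimage
        (f := fun w : (OfDim X n × X) × X => (w.1.1.1, w.1.2 - w.2))
        (by fun_prop)
  · have : ∀ᶠ z : OfDim X n × X in 𝓝 (A, v), ‖z.2‖ < ‖v‖ + 1 :=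
      ContinuousAt.eventually_lt (by fun_prop) (by fun_prop) (by simp)
    filter_upwards [this] with z hz
    rw [mem_closedBall_zero_iff]
    exact (Submodule.norm_starProjection_apply_le _ _).trans hz.le
  · refine fun z => ⟨Submodule.starProjection_apply_mem (Submodule.span ℝ z.1.1.carrier) z.2, fun x hx => ?_⟩
    rw [mem_singleton_iff, real_inner_comm]
    exact Submodule.starProjection_inner_eq_zero _ _ (Submodule.subset_span hx)
  · rintro w ⟨hw, hw'⟩
    refine (Submodule.eq_starProjection_of_mem_orthogonal hw ?_).symm
    rw [Submodule.mem_orthogonal]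
    intro u hu
    induction hu using Submodule.span_induction with
    | mem y hy => exact hw' y hy
    | zero => exact inner_zero_left _
    | add a b _ _ ha hb => rw [inner_add_left, ha, hb, add_zero]
    | smul t a _ ha => rw [real_inner_smul_left, ha, mul_zero]

/-! ### Continuity of the normalised generator -/

/-- The assumptions of facial compactness and local smoothness, for an index `1 ≤ j ≤ d`. -/
structure Admissible (C : ProperCone ℝ X) (j : ℕ) : Prop where
  compact : FaciallyCompact (C : Set X)
  smooth : LocallySmooth (C : Set X)
  one_le : 1 ≤ j
  le_depth : j ≤ depth (C : Set X)

/-- The vector `e_F(E)` for a flag `(E, F)`. -/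
noncomputable abbrev gen {C : Set X} {j : ℕ} (q : flags C j) : X := (flagMap C j q).2

variable {C : ProperCone ℝ X} {j : ℕ}

namespace Admissible

variable (h : Admissible C j)
include h

theorem isNormalisedGenerator (q : flags (C : Set X) j) :
    IsNormalisedGenerator q.1.1.carrier q.1.2.carrier (gen q) :=
  Classical.epsilon_spec
    (exists_isNormalisedGenerator h.smooth h.one_le h.le_depth q.2.1 q.2.2.1 q.2.2.2)

theorem norm_gen (q : flags (C : Set X) j) : ‖gen q‖ = 1 := (h.isNormalisedGenerator q).1

theorem gen_inner_nonneg (q : flags (C : Set X) j) {x : X} (hx : x ∈ q.1.1.carrier) :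
    0 ≤ ⟪x, gen q⟫ := (mem_relDualFace.1 (h.isNormalisedGenerator q).mem).2.1 x hx

theorem gen_mem_span (q : flags (C : Set X) j) :
    gen q ∈ Submodule.span ℝ q.1.1.carrier :=
  (mem_relDualFace.1 (h.isNormalisedGenerator q).mem).2.2

theorem gen_mem_orthogonal (q : flags (C : Set X) j) :
    gen q ∈ (Submodule.span ℝ q.1.2.carrier)ᗮ :=
  (mem_relDualFace.1 (h.isNormalisedGenerator q).mem).1

theorem inner_gen_eq_zero (q : flags (C : Set X) j) {x : X} (hx : x ∈ q.1.2.carrier) :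
    ⟪x, gen q⟫ = 0 := h.gen_mem_orthogonal q x (Submodule.subset_span hx)

/-- The smaller face is recovered from `E` and `e_F(E)`. -/
theorem bot_eq (q : flags (C : Set X) j) :
    q.1.2.carrier = q.1.1.carrier ∩ {y | ⟪y, gen q⟫ = 0} := by
  have hface := (isFace_top q).inter_orthogonal fun y hy => h.gen_inner_nonneg q hy
  have hclosed : IsClosed (q.1.1.carrier ∩ {y | ⟪y, gen q⟫ = 0}) :=
    q.1.1.isClosed_carrier.inter (isClosed_eq (by fun_prop) continuous_const)
  -- The right side is a face containing `F`, of dimension below `dim E` and therefore at most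
  -- `n_{d-j} = dim F`.
  refine (isFace_bot q).eq_of_subset_of_dim_le hface
    (fun y hy => ⟨q.2.2.2 hy, h.inner_gen_eq_zero q hy⟩) ?_
  rw [q.2.2.1.2]
  refine dim_le_of_dim_lt h.one_le (G := ⟨_, hclosed⟩) hface ?_
  rw [← q.2.1.2]
  exact dim_inter_orthogonal_lt (h.gen_mem_span q) (by
    rw [← norm_ne_zero_iff, h.norm_gen]; exact one_ne_zero)

theorem injective_flagMap : Function.Injective (flagMap (C : Set X) j) := by
  intro q q' hq
  have h₁ : q.1.1 = q'.1.1 := congrArg Subtype.val (congrArg Prod.fst hq)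
  have h₂ : gen q = gen q' := congrArg Prod.snd hq
  refine Subtype.ext (Prod.ext h₁ (ClosedSubsets.ext_carrier ?_))
  rw [h.bot_eq q, h.bot_eq q', h₁, h₂]

theorem isCompact_flags : IsCompact (flags (C : Set X) j) := by
  have := ((h.compact (j - 1) (by have := h.le_depth; omega)).prod
    (h.compact j h.le_depth)).inter_right
      (ClosedSubsets.isClosed_subset.preimage continuous_swap)
  convert this using 1
  ext q
  exact ⟨fun hq => ⟨⟨hq.1, hq.2.1⟩, hq.2.2⟩, fun hq => ⟨hq.1.1, hq.1.2, hq.2⟩⟩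

theorem compactSpace_flags : CompactSpace (flags (C : Set X) j) :=
  isCompact_iff_compactSpace.1 h.isCompact_flags

theorem compactSpace_flagBase : CompactSpace (flagBase (C : Set X) j) :=
  isCompact_iff_compactSpace.1 (h.isCompact_flags.image continuous_fst)

/-- Closed-graph criterion with values in the unit sphere: the defining conditions are closed in
flag and vector, and a ray contains only one unit vector. -/
theorem continuous_gen : Continuous fun q : flags (C : Set X) j => gen q := by
  rw [continuous_iff_continuousAt]
  intro q₀
  refine continuousAt_of_isClosed_relation
    (R := ({w : flags (C : Set X) j × X | w.2 ∈ Submodule.span ℝ w.1.1.1.carrier} ∩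
      {w | ∀ x ∈ w.1.1.1.carrier, ⟪x, w.2⟫ ∈ Ici (0 : ℝ)}) ∩
      ({w | ∀ x ∈ w.1.1.2.carrier, ⟪x, w.2⟫ ∈ ({0} : Set ℝ)} ∩ {w | ‖w.2‖ = 1})) ?_
    (isCompact_sphere (0 : X) 1) (Eventually.of_forall fun q => ?_) ?_ ?_
  · refine ((IsClosed.inter ?_ ?_).inter (IsClosed.inter ?_ ?_))
    · exact isClosed_mem_span.preimage
        (f := fun w : flags (C : Set X) j × X => (topFace (flagProj (C : Set X) j w.1), w.2))
        ((continuous_topFace.comp (continuous_flagProj.comp continuous_fst)).prodMk continuous_snd)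
    · exact (isClosed_forall_inner_mem (X := X) isClosed_Ici).preimage
        (f := fun w : flags (C : Set X) j × X => (w.1.1.1, w.2)) (by fun_prop)
    · exact (isClosed_forall_inner_mem (X := X) isClosed_singleton).preimage
        (f := fun w : flags (C : Set X) j × X => (w.1.1.2, w.2)) (by fun_prop)
    · exact isClosed_eq (by fun_prop) continuous_const
  · rw [mem_sphere_zero_iff_norm]
    exact h.norm_gen q
  · exact fun q => ⟨⟨h.gen_mem_span q, fun x hx => h.gen_inner_nonneg q hx⟩,
      fun x hx => h.inner_gen_eq_zero q hx, h.norm_gen q⟩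
  · rintro v ⟨⟨hv₁, hv₂⟩, hv₃, hv₄⟩
    have hv : v ∈ relDualFace q₀.1.1.carrier q₀.1.2.carrier := by
      refine mem_relDualFace.2 ⟨?_, hv₂, hv₁⟩
      obtain ⟨x, hx⟩ := (isFace_bot q₀).exists_mem_intrinsicInterior
      exact mem_orthogonal_span_of_intrinsicInterior (isFace_bot q₀).zero_mem hx
        (fun y hy => hv₂ y (q₀.2.2.2 hy)) (hv₃ x (intrinsicInterior_subset hx))
    rw [(h.isNormalisedGenerator q₀).eq_smul hv, show ‖v‖ = 1 from hv₄, one_smul]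

theorem continuous_flagMap : Continuous (flagMap (C : Set X) j) :=
  continuous_flagProj.prodMk h.continuous_gen

theorem isClosedEmbedding_flagMap :
    Topology.IsClosedEmbedding (flagMap (C : Set X) j) :=
  have := h.compactSpace_flags
  h.continuous_flagMap.isClosedEmbedding h.injective_flagMap

/-! ### The half-spaces -/

theorem mem_halfSpace (q : flags (C : Set X) j) {v : X} :
    v ∈ halfSpace q.1.1.carrier q.1.2.carrier ↔ v ∈ Submodule.span ℝ q.1.1.carrier ∧
      v ∈ (Submodule.span ℝ q.1.2.carrier)ᗮ ∧ ⟪gen q, v⟫ = 0 := by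
  have hspan : Submodule.span ℝ (relDualFace q.1.1.carrier q.1.2.carrier) =
      Submodule.span ℝ {gen q} := by
    refine le_antisymm (Submodule.span_le.2 ?_) (Submodule.span_mono ?_)
    · intro f hf
      rw [(h.isNormalisedGenerator q).eq_smul hf]
      exact Submodule.smul_mem _ _ (Submodule.mem_span_singleton_self _)
    · exact singleton_subset_iff.2 (h.isNormalisedGenerator q).mem
  rw [halfSpace, hspan, Submodule.mem_inf, Submodule.mem_inf, and_assoc,
    Submodule.mem_orthogonal_singleton_iff_inner_right]

/-- `⟨E⟩` is the orthogonal sum of `⟨F⟩`, the line of `e_F(E)` and `E_{1/2}(F)`. The formula reduces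
continuity of the half-space to that of the two spans and the generator. -/
theorem starProjection_halfSpace (q : flags (C : Set X) j) (v : X) :
    (halfSpace q.1.1.carrier q.1.2.carrier).starProjection v =
      (Submodule.span ℝ q.1.1.carrier).starProjection v -
        (Submodule.span ℝ q.1.2.carrier).starProjection v - ⟪gen q, v⟫ • gen q := by
  have hFE : Submodule.span ℝ q.1.2.carrier ≤ Submodule.span ℝ q.1.1.carrier :=
    Submodule.span_mono q.2.2.2
  refine Submodule.eq_starProjection_of_mem_orthogonal ((h.mem_halfSpace q).2 ⟨?_, ?_, ?_⟩) ?_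
  · exact Submodule.sub_mem _ (Submodule.sub_mem _ (Submodule.starProjection_apply_mem _ _)
      (hFE (Submodule.starProjection_apply_mem _ _)))
      (Submodule.smul_mem _ _ (h.gen_mem_span q))
  · refine Submodule.sub_mem _ ?_ (Submodule.smul_mem _ _ (h.gen_mem_orthogonal q))
    have h₁ := Submodule.sub_starProjection_mem_orthogonal
      (K := Submodule.span ℝ q.1.2.carrier) v
    have h₂ := Submodule.orthogonal_le hFE (Submodule.sub_starProjection_mem_orthogonal
      (K := Submodule.span ℝ q.1.1.carrier) v)
    convert Submodule.sub_mem _ h₁ h₂ using 1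
    abel
  · have h₁ : ⟪gen q, (Submodule.span ℝ q.1.1.carrier).starProjection v⟫ = ⟪gen q, v⟫ := by
      rw [← Submodule.inner_starProjection_left_eq_right,
        Submodule.starProjection_eq_self_iff.2 (h.gen_mem_span q)]
    have h₂ : ⟪gen q, (Submodule.span ℝ q.1.2.carrier).starProjection v⟫ = 0 := by
      rw [real_inner_comm]
      exact h.gen_mem_orthogonal q _ (Submodule.starProjection_apply_mem _ _)
    rw [inner_sub_right, inner_sub_right, h₁, h₂, real_inner_smul_right,
      real_inner_self_eq_norm_sq, h.norm_gen]
    ring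
  · rw [Submodule.mem_orthogonal']
    intro u hu
    obtain ⟨hu₁, hu₂, hu₃⟩ := (h.mem_halfSpace q).1 hu
    have h₁ : ⟪(Submodule.span ℝ q.1.1.carrier).starProjection v, u⟫ = ⟪v, u⟫ := by
      rw [Submodule.inner_starProjection_left_eq_right,
        Submodule.starProjection_eq_self_iff.2 hu₁]
    rw [inner_sub_left, inner_sub_left, inner_sub_left, h₁, real_inner_smul_left, hu₃,
      hu₂ _ (Submodule.starProjection_apply_mem _ _)]
    ring

theorem continuous_starProjection_halfSpace : Continuous fun q : flags (C : Set X) j =>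
    (halfSpace q.1.1.carrier q.1.2.carrier).starProjection := by
  rw [continuous_clm_apply]
  intro v
  simp_rw [h.starProjection_halfSpace]
  have h₁ : Continuous fun q : flags (C : Set X) j =>
      (Submodule.span ℝ q.1.1.carrier).starProjection v :=
    (continuous_starProjection_span (X := X)).comp
      (f := fun q : flags (C : Set X) j => (topFace (flagProj (C : Set X) j q), v))
      ((continuous_topFace.comp continuous_flagProj).prodMk continuous_const)
  have h₂ : Continuous fun q : flags (C : Set X) j =>
      (Submodule.span ℝ q.1.2.carrier).starProjection v :=
    (continuous_starProjection_span (X := X)).comp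
      (f := fun q : flags (C : Set X) j => (botFace q, v))
      (continuous_botFace.prodMk continuous_const)
  have h₃ := h.continuous_gen
  fun_prop

theorem finrank_halfSpace (q : flags (C : Set X) j) :
    Module.finrank ℝ (halfSpace q.1.1.carrier q.1.2.carrier) = fibreDim (C : Set X) j := by
  have hgen : gen q ≠ 0 := by
    rw [← norm_ne_zero_iff, h.norm_gen]
    exact one_ne_zero
  have hle : Submodule.span ℝ q.1.2.carrier ⊔ Submodule.span ℝ {gen q} ≤
      Submodule.span ℝ q.1.1.carrier :=
    sup_le (Submodule.span_mono q.2.2.2)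
      ((Submodule.span_singleton_le_iff_mem _ _).2 (h.gen_mem_span q))
  have heq : (Submodule.span ℝ q.1.2.carrier ⊔ Submodule.span ℝ {gen q})ᗮ ⊓
      Submodule.span ℝ q.1.1.carrier = halfSpace q.1.1.carrier q.1.2.carrier := by
    ext v
    rw [h.mem_halfSpace, ← Submodule.inf_orthogonal, Submodule.mem_inf, Submodule.mem_inf,
      Submodule.mem_orthogonal_singleton_iff_inner_right]
    tauto
  have hinf : Submodule.span ℝ q.1.2.carrier ⊓ Submodule.span ℝ {gen q} = ⊥ := by
    rw [Submodule.eq_bot_iff]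
    rintro v ⟨hv₁, hv₂⟩
    obtain ⟨t, rfl⟩ := Submodule.mem_span_singleton.1 hv₂
    have := h.gen_mem_orthogonal q _ hv₁
    rw [real_inner_smul_left, real_inner_self_eq_norm_sq, h.norm_gen] at this
    rw [show t = 0 by linarith, zero_smul]
  have h₁ := Submodule.finrank_add_inf_finrank_orthogonal hle
  have h₂ := Submodule.finrank_sup_add_finrank_inf_eq (Submodule.span ℝ q.1.2.carrier)
    (Submodule.span ℝ {gen q})
  rw [heq] at h₁
  rw [hinf, finrank_bot, finrank_span_singleton hgen] at h₂
  have h₃ : Module.finrank ℝ (Submodule.span ℝ q.1.1.carrier) = _ := q.2.1.2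
  have h₄ : Module.finrank ℝ (Submodule.span ℝ q.1.2.carrier) = _ := q.2.2.1.2
  rw [fibreDim]
  omega

end Admissible

end ConeFace

/-! ### Secants of the fibres converge to the half-space. -/

namespace ConeFace

open Topology Filter Set Asymptotics
open scoped RealInnerProductSpace

variable {X : Type*} [NormedAddCommGroup X] [InnerProductSpace ℝ X] [FiniteDimensional ℝ X]
  {C : ProperCone ℝ X} {j : ℕ}

/-- The filter of pairs of flags over the same point of the base which tend to `q₀`. -/
def pairFilter (q₀ : flags (C : Set X) j) : Filter (flags (C : Set X) j × flags (C : Set X) j) :=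
  𝓝 (q₀, q₀) ⊓ 𝓟 {z | flagProj (C : Set X) j z.1 = flagProj (C : Set X) j z.2}

theorem isLittleO_of_forall_isLittleO_inner {α : Type*} {l : Filter α} {w : α → X}
    {T : Submodule ℝ X} (hw : ∀ x ∈ Tᗮ, (fun a => ⟪x, w a⟫) =o[l] w) :
    (fun a => w a - T.starProjection (w a)) =o[l] w := by
  let b := stdOrthonormalBasis ℝ Tᗮ
  have key : ∀ v : X, v - T.starProjection v = ∑ i, ⟪(b i : X), v⟫ • (b i : X) := fun v => by
    have hv : v - T.starProjection v ∈ Tᗮ := Submodule.sub_starProjection_mem_orthogonal v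
    have h₁ := congrArg Subtype.val (b.sum_repr' ⟨_, hv⟩)
    rw [Submodule.coe_sum] at h₁
    refine h₁.symm.trans ?_
    refine Finset.sum_congr rfl fun i _ => ?_
    rw [Submodule.coe_smul, Submodule.coe_inner]
    congr 1
    rw [inner_sub_right, real_inner_comm (T.starProjection v),
      (b i).2 _ (Submodule.starProjection_apply_mem T v), sub_zero]
  simp_rw [key]
  refine IsLittleO.fun_sum fun i _ => ?_
  exact ((ContinuousLinearMap.toSpanSingleton ℝ (b i : X)).isBigO_comp _ _).trans_isLittleO
    (hw _ (b i).2)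

namespace Admissible

variable (h : Admissible C j)
include h

/-- For flags `(E', F₁)`, `(E', F₂)` with generators `e₁`, `e₂`, the secant `e₂ - e₁` is
non-negative on `F₁`, where `e₁` vanishes, and non-positive on `F₂`, where `e₂` vanishes. Both faces
contain points within `δ` of `x`, so its value at `x` is at most `δ ‖e₂ - e₁‖` in absolute value. -/
theorem isLittleO_inner_of_mem_bot (q₀ : flags (C : Set X) j) {x : X} (hx : x ∈ q₀.1.2.carrier) :
    (fun z : flags (C : Set X) j × flags (C : Set X) j => ⟪x, gen z.2 - gen z.1⟫)
      =o[pairFilter q₀] fun z => gen z.2 - gen z.1 := by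
  rw [isLittleO_iff]
  intro δ hδ
  have hhit : ∀ᶠ q : flags (C : Set X) j in 𝓝 q₀, ∃ y ∈ q.1.2.carrier, y ∈ Metric.ball x δ :=
    ((continuous_snd.comp continuous_subtype_val).tendsto q₀).eventually
      (ClosedSubsets.eventually_hit hx (Metric.ball_mem_nhds x hδ))
  have hhit₂ := hhit.prod_nhds hhit
  rw [pairFilter, eventually_inf_principal]
  filter_upwards [hhit₂] with z hz hpr
  obtain ⟨⟨y, hy, hyx⟩, y', hy', hyx'⟩ := hz
  have hE : z.1.1.1 = z.2.1.1 := congrArg Subtype.val hpr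
  rw [mem_ball_iff_norm] at hyx hyx'
  set w := gen z.2 - gen z.1 with hw
  have h₁ : 0 ≤ ⟪y, w⟫ := by
    rw [hw, inner_sub_right, h.inner_gen_eq_zero z.1 hy, sub_zero]
    exact h.gen_inner_nonneg z.2 (hE ▸ z.1.2.2.2 hy)
  have h₂ : ⟪y', w⟫ ≤ 0 := by
    rw [hw, inner_sub_right, h.inner_gen_eq_zero z.2 hy', zero_sub, neg_nonpos]
    exact h.gen_inner_nonneg z.1 (hE ▸ z.2.2.2.2 hy')
  have h₃ := (abs_le.1 (abs_real_inner_le_norm (y - x) w)).2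
  have h₄ := (abs_le.1 (abs_real_inner_le_norm (y' - x) w)).1
  have h₅ := mul_le_mul_of_nonneg_right hyx.le (norm_nonneg w)
  have h₆ := mul_le_mul_of_nonneg_right hyx'.le (norm_nonneg w)
  rw [inner_sub_left] at h₃ h₄
  rw [Real.norm_eq_abs, abs_le]
  constructor <;> linarith

/-- A chord of the unit sphere is orthogonal to the sum of its endpoints, and half this sum tends to
`gen q₀`. -/
theorem isLittleO_inner_gen (q₀ : flags (C : Set X) j) :
    (fun z : flags (C : Set X) j × flags (C : Set X) j => ⟪gen q₀, gen z.2 - gen z.1⟫)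
      =o[pairFilter q₀] fun z => gen z.2 - gen z.1 := by
  rw [isLittleO_iff]
  intro δ hδ
  have hcont : Continuous fun z : flags (C : Set X) j × flags (C : Set X) j =>
      ‖gen q₀ - (1 / 2 : ℝ) • (gen z.1 + gen z.2)‖ := by
    have h₁ := h.continuous_gen.comp (continuous_fst (X := flags (C : Set X) j)
      (Y := flags (C : Set X) j))
    have h₂ := h.continuous_gen.comp (continuous_snd (X := flags (C : Set X) j)
      (Y := flags (C : Set X) j))
    exact (continuous_const.sub ((h₁.add h₂).const_smul _)).norm
  have hev : ∀ᶠ z in 𝓝 (q₀, q₀), ‖gen q₀ - (1 / 2 : ℝ) • (gen z.1 + gen z.2)‖ < δ := by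
    refine hcont.continuousAt.eventually_lt continuousAt_const ?_
    rw [← two_smul ℝ, smul_smul]
    simpa using hδ
  refine (hev.filter_mono inf_le_left).mono fun z hz => ?_
  have h₀ : ⟪gen z.1 + gen z.2, gen z.2 - gen z.1⟫ = 0 := by
    rw [inner_sub_right, inner_add_left, inner_add_left, real_inner_self_eq_norm_sq,
      real_inner_self_eq_norm_sq, h.norm_gen, h.norm_gen, real_inner_comm]
    ring
  have h₁ : ⟪gen q₀, gen z.2 - gen z.1⟫ =
      ⟪gen q₀ - (1 / 2 : ℝ) • (gen z.1 + gen z.2), gen z.2 - gen z.1⟫ := by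
    rw [inner_sub_left, real_inner_smul_left, h₀]
    ring
  rw [h₁]
  exact (norm_inner_le_norm _ _).trans (mul_le_mul_of_nonneg_right hz.le (norm_nonneg _))

/-- The secant lies in the span of the common larger face, and the projection of `x` to that span
tends to its projection to `⟨E⟩`, which is zero. -/
theorem isLittleO_inner_of_mem_orthogonal (q₀ : flags (C : Set X) j) {x : X}
    (hx : x ∈ (Submodule.span ℝ q₀.1.1.carrier)ᗮ) :
    (fun z : flags (C : Set X) j × flags (C : Set X) j => ⟪x, gen z.2 - gen z.1⟫)
      =o[pairFilter q₀] fun z => gen z.2 - gen z.1 := by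
  rw [isLittleO_iff]
  intro δ hδ
  have hcont : Continuous fun z : flags (C : Set X) j × flags (C : Set X) j =>
      ‖(Submodule.span ℝ z.1.1.1.carrier).starProjection x‖ :=
    ((continuous_starProjection_span (X := X)).comp
      (f := fun z : flags (C : Set X) j × flags (C : Set X) j =>
        (topFace (flagProj (C : Set X) j z.1), x))
      ((continuous_topFace.comp (continuous_flagProj.comp continuous_fst)).prodMk
        continuous_const)).norm
  have hev : ∀ᶠ z in 𝓝 (q₀, q₀),
      ‖(Submodule.span ℝ z.1.1.1.carrier).starProjection x‖ < δ := by
    refine hcont.continuousAt.eventually_lt continuousAt_const ?_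
    rw [Submodule.starProjection_apply_eq_zero_iff _ |>.2 hx, norm_zero]
    exact hδ
  rw [pairFilter, eventually_inf_principal]
  filter_upwards [hev] with z hz hpr
  have hE : z.1.1.1 = z.2.1.1 := congrArg Subtype.val hpr
  have hw : gen z.2 - gen z.1 ∈ Submodule.span ℝ z.1.1.1.carrier :=
    Submodule.sub_mem _ (hE ▸ h.gen_mem_span z.2) (h.gen_mem_span z.1)
  have h₁ : ⟪x, gen z.2 - gen z.1⟫ =
      ⟪(Submodule.span ℝ z.1.1.1.carrier).starProjection x, gen z.2 - gen z.1⟫ := by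
    rw [Submodule.inner_starProjection_left_eq_right, Submodule.starProjection_eq_self_iff.2 hw]
  rw [h₁]
  exact (norm_inner_le_norm _ _).trans (mul_le_mul_of_nonneg_right hz.le (norm_nonneg _))

/-- The secants of the fibres of `(ξ, 𝐞)` tend to the half-space. -/
theorem isLittleO_secant (q₀ : flags (C : Set X) j) :
    (fun z : flags (C : Set X) j × flags (C : Set X) j => gen z.2 - gen z.1 -
      (halfSpace q₀.1.1.carrier q₀.1.2.carrier).starProjection (gen z.2 - gen z.1))
      =o[pairFilter q₀] fun z => gen z.2 - gen z.1 := by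
  refine isLittleO_of_forall_isLittleO_inner fun x hx => ?_
  have hx₀ := (Submodule.starProjection_apply_eq_zero_iff _).2 hx
  rw [h.starProjection_halfSpace, sub_eq_zero, sub_eq_iff_eq_add] at hx₀
  -- The complement of the half-space splits into `⟨E⟩^⊥`, the line of `e_F(E)` and `⟨F⟩`; each part
  -- has its own estimate.
  have hdecomp : x = (x - (Submodule.span ℝ q₀.1.1.carrier).starProjection x) +
      (⟪gen q₀, x⟫ • gen q₀ + (Submodule.span ℝ q₀.1.2.carrier).starProjection x) := by
    rw [← hx₀]; abel
  have hF : ∀ v ∈ Submodule.span ℝ q₀.1.2.carrier,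
      (fun z : flags (C : Set X) j × flags (C : Set X) j => ⟪v, gen z.2 - gen z.1⟫)
        =o[pairFilter q₀] fun z => gen z.2 - gen z.1 := by
    intro v hv
    induction hv using Submodule.span_induction with
    | mem y hy => exact h.isLittleO_inner_of_mem_bot q₀ hy
    | zero => simp_rw [inner_zero_left]; exact isLittleO_zero _ _
    | add a b _ _ ha hb => simp_rw [inner_add_left]; exact ha.add hb
    | smul t a _ ha => simp_rw [real_inner_smul_left]; exact ha.const_mul_left t
  rw [hdecomp]
  simp_rw [inner_add_left _ _ (gen _ - gen _), real_inner_smul_left _ (gen _ - gen _)]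
  exact (h.isLittleO_inner_of_mem_orthogonal q₀
    (Submodule.sub_starProjection_mem_orthogonal x)).add
      (((h.isLittleO_inner_gen q₀).const_mul_left _).add
        (hF _ (Submodule.starProjection_apply_mem _ _)))

end Admissible

end ConeFace

/-! ### Facial compactness: supporting functionals near a relative interior point. -/

namespace ConeFace

open Topology Filter Set
open scoped RealInnerProductSpace

variable {X : Type*} [NormedAddCommGroup X] [InnerProductSpace ℝ X] [FiniteDimensional ℝ X]
  {C : ProperCone ℝ X} {j : ℕ}

theorem eventually_notMem_of_isCompact {K : Set (ClosedSubsets X)} (hK : IsCompact K) {x₀ : X}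
    (hx₀ : ∀ G ∈ K, x₀ ∉ G.carrier) : ∀ᶠ x in 𝓝 x₀, ∀ G ∈ K, x ∉ G.carrier :=
  hK.eventually_forall_of_forall_eventually fun G hG =>
    ClosedSubsets.isClosed_mem.isOpen_compl.mem_nhds (hx₀ G hG)

namespace Admissible

variable (h : Admissible C j)
include h

/-- The proper faces near a relative interior point of the smaller face of a flag are near this
face. -/
theorem eventually_mem_of_mem_face (q₀ : flags (C : Set X) j) {x₀ : X}
    (hx₀ : x₀ ∈ intrinsicInterior ℝ q₀.1.2.carrier) {B : Set (ClosedSubsets X)} (hB : IsOpen B)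
    (hqB : q₀.1.2 ∈ B) :
    ∀ᶠ x in 𝓝 x₀, ∀ l, j ≤ l → l ≤ depth (C : Set X) → ∀ G ∈ facesAt (C : Set X) l,
      x ∈ G.carrier → l = j ∧ G ∈ B := by
  have hsub : ∀ l, ∀ G ∈ facesAt (C : Set X) l, x₀ ∈ G.carrier → q₀.1.2.carrier ⊆ G.carrier :=
    fun l G hG hx => hG.1.subset_of_mem_intrinsicInterior (isFace_bot q₀) hx₀ hx
  -- The faces in `P_j` outside `B` form a compact set. One through `x₀` would contain `F`, and
  -- hence equal it by dimension.
  have h₁ : ∀ᶠ x in 𝓝 x₀, ∀ G ∈ facesAt (C : Set X) j \ B, x ∉ G.carrier := by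
    refine eventually_notMem_of_isCompact ((h.compact j h.le_depth).diff hB) ?_
    rintro G ⟨hG, hGB⟩ hx
    refine hGB ?_
    have := (isFace_bot q₀).eq_of_subset_of_dim_le hG.1 (hsub j G hG hx)
      (by rw [hG.2, q₀.2.2.1.2])
    rwa [← ClosedSubsets.ext_carrier this]
  -- A face of smaller dimension cannot contain `F`, so none passes through `x₀`.
  have h₂ : ∀ᶠ x in 𝓝 x₀, ∀ l ∈ Ioc j (depth (C : Set X)), ∀ G ∈ facesAt (C : Set X) l,
      x ∉ G.carrier := by
    rw [eventually_all_finite (finite_Ioc _ _)]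
    rintro l ⟨hjl, hld⟩
    refine eventually_notMem_of_isCompact (h.compact l hld) fun G hG hx => ?_
    have := dim_mono (hsub l G hG hx)
    rw [hG.2, q₀.2.2.1.2] at this
    have := faceDim_lt (C := C) (i := depth (C : Set X) - l) (i' := depth (C : Set X) - j)
      (by omega) (by omega)
    omega
  filter_upwards [h₁, h₂] with x hx₁ hx₂ l hjl hld G hG hxG
  rcases hjl.eq_or_lt with rfl | hlt
  · refine ⟨rfl, ?_⟩
    by_contra hGB
    exact hx₁ G ⟨hG, hGB⟩ hxG
  · exact absurd hxG (hx₂ l ⟨hlt, hld⟩ G hG)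

/-- Near a relative interior point of the smaller face of a flag, all functionals which support
the larger face are generators of the relative dual faces of nearby flags. -/
theorem eventually_exists_flag (q₀ : flags (C : Set X) j) {x₀ : X}
    (hx₀ : x₀ ∈ intrinsicInterior ℝ q₀.1.2.carrier) {N : Set (flags (C : Set X) j)}
    (hN : N ∈ 𝓝 q₀) :
    ∀ᶠ z : flagBase (C : Set X) j × X in 𝓝 (flagProj (C : Set X) j q₀, x₀),
      z.2 ∈ z.1.1.carrier → ∀ f ∈ relDual z.1.1.carrier, f ≠ 0 → ⟪z.2, f⟫ = 0 →
        ∃ q ∈ N, flagProj (C : Set X) j q = z.1 ∧ gen q = ‖f‖⁻¹ • f := by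
  obtain ⟨u, hu, huN⟩ := mem_nhds_subtype _ _ _ |>.1 hN
  obtain ⟨A, B, hA, hqA, hB, hqB, hAB⟩ := mem_nhds_prod_iff'.1 hu
  have hA' : ∀ᶠ y : flagBase (C : Set X) j in 𝓝 (flagProj (C : Set X) j q₀), y.1 ∈ A :=
    (continuous_subtype_val.tendsto (flagProj (C : Set X) j q₀)).eventually (hA.mem_nhds hqA)
  filter_upwards [hA'.prod_nhds (h.eventually_mem_of_mem_face q₀ hx₀ hB hqB)]
  rintro ⟨y, x⟩ ⟨hyA, hx⟩ hxE f hf hf0 hxf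
  obtain ⟨hf₁, hf₂⟩ := mem_relDual.1 hf
  -- The zero set of `f` on the larger face is a proper face of it through a point near `x₀`, so it
  -- lies in `P_j` and is near `F`.
  have hface := (flagBase_isFace y).inter_orthogonal hf₁
  have hclosed : IsClosed (y.1.carrier ∩ {x | ⟪x, f⟫ = 0}) :=
    y.1.isClosed_carrier.inter (isClosed_eq (by fun_prop) continuous_const)
  let G : ClosedSubsets X := ⟨_, hclosed⟩
  have hdim : dim G.carrier < dim y.1.carrier := dim_inter_orthogonal_lt hf₂ hf0
  rw [flagBase_dim] at hdim
  obtain ⟨l, hjl, hld, hG⟩ := exists_mem_facesAt h.one_le hface hdim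
  obtain ⟨rfl, hGB⟩ := hx l hjl hld G hG ⟨hxE, hxf⟩
  let q : flags (C : Set X) l :=
    ⟨(y.1, G), ⟨flagBase_isFace y, flagBase_dim y⟩, hG, inter_subset_left⟩
  refine ⟨q, huN (hAB ⟨hyA, hGB⟩), Subtype.ext rfl, ?_⟩
  have hmem : f ∈ relDualFace q.1.1.carrier q.1.2.carrier := by
    refine mem_relDualFace.2 ⟨?_, hf₁, hf₂⟩
    rw [Submodule.mem_orthogonal]
    have hle : Submodule.span ℝ q.1.2.carrier ≤ (Submodule.span ℝ {f})ᗮ := by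
      rw [Submodule.span_le]
      rintro v ⟨-, hv⟩
      exact Submodule.mem_orthogonal_singleton_iff_inner_left.2 hv
    exact fun v hv => Submodule.mem_orthogonal_singleton_iff_inner_left.1 (hle hv)
  conv_rhs => rw [(h.isNormalisedGenerator q).eq_smul hmem]
  rw [norm_smul, norm_norm, h.norm_gen q, mul_one, smul_smul,
    inv_mul_cancel₀ (norm_ne_zero_iff.2 hf0), one_smul]

end Admissible

end ConeFace

/-! ### Nearest points and the variational proof that projections fill a neighbourhood. -/

namespace ConeFace

open Topology Filter Set
open scoped RealInnerProductSpace

variable {X : Type*} [NormedAddCommGroup X] [InnerProductSpace ℝ X]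
  {C : ProperCone ℝ X} {j : ℕ}

/-- The residual of a nearest point of a face supports the face at this point. -/
theorem IsFace.inner_sub_nearest {E : Set X} (hE : IsFace (C : Set X) E) {x z : X} (hx : x ∈ E)
    (hxz : Metric.infDist z E = dist z x) :
    (∀ y ∈ E, 0 ≤ ⟪y, x - z⟫) ∧ ⟪x, x - z⟫ = 0 := by
  have hvar : ∀ w ∈ E, ⟪z - x, w - x⟫ ≤ 0 := by
    rw [← norm_eq_iInf_iff_real_inner_le_zero hE.convex hx, ← dist_eq_norm, ← hxz,
      Metric.infDist_eq_iInf]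
    simp_rw [dist_eq_norm]
  -- Testing the variational inequality at `0` and `2x` gives both signs of `⟪z - x, x⟫`.
  have h₀ := hvar 0 hE.zero_mem
  have h₂ := hvar _ (hE.smul_mem hx (zero_le_two (α := ℝ)))
  rw [two_smul, add_sub_cancel_right] at h₂
  rw [zero_sub, inner_neg_right] at h₀
  have hxx : ⟪z - x, x⟫ = 0 := by linarith
  have hneg : ∀ y : X, ⟪y, x - z⟫ = -⟪z - x, y⟫ := fun y => by
    rw [real_inner_comm, ← inner_neg_left, neg_sub]
  refine ⟨fun y hy => ?_, by rw [hneg, hxx, neg_zero]⟩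
  have := hvar y hy
  rw [inner_sub_right, hxx] at this
  rw [hneg]
  linarith

theorem flagBase_nonempty (y : flagBase (C : Set X) j) : y.1.carrier.Nonempty :=
  (flagBase_isFace y).nonempty

/-- The first order condition for a local minimum of `s ↦ ‖u + s • w‖ + s * c`. -/
theorem inner_eq_of_eventually_norm_le {u w : X} {c : ℝ} (hu : u ≠ 0)
    (hmin : ∀ᶠ s : ℝ in 𝓝 0, ‖u‖ ≤ ‖u + s • w‖ + s * c) : ⟪u, w⟫ = -(‖u‖ * c) := by
  have hr : 0 < ‖u‖ := norm_pos_iff.2 hu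
  -- With `r = ‖u‖`, `t ≤ (t² / r + r) / 2` with equality at `t = r`. So `φ` is a differentiable
  -- majorant with the same value at `0`, and it inherits the local minimum.
  let φ : ℝ → ℝ := fun s => (‖u + s • w‖ ^ 2 / ‖u‖ + ‖u‖) / 2 + s * c
  have hφ : IsLocalMin φ 0 := by
    filter_upwards [hmin] with s hs
    have h₁ : φ 0 = ‖u‖ := by
      simp only [φ, zero_smul, add_zero, zero_mul]
      field_simp
      ring
    have h₂ : ‖u + s • w‖ ≤ (‖u + s • w‖ ^ 2 / ‖u‖ + ‖u‖) / 2 := by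
      rw [le_div_iff₀ two_pos, ← sub_nonneg]
      have : ‖u + s • w‖ ^ 2 / ‖u‖ + ‖u‖ - ‖u + s • w‖ * 2 = (‖u + s • w‖ - ‖u‖) ^ 2 / ‖u‖ := by
        field_simp
        ring
      rw [this]
      positivity
    rw [h₁]
    simp only [φ]
    linarith
  have hderiv : HasDerivAt φ ((2 * ⟪u + (0 : ℝ) • w, w⟫ / ‖u‖ + 0) / 2 + 1 * c) 0 := by
    have h₁ : HasDerivAt (fun s : ℝ => u + s • w) w 0 := by
      simpa using ((hasDerivAt_id (0 : ℝ)).smul_const w).const_add u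
    exact (((h₁.norm_sq.div_const _).add (hasDerivAt_const _ _)).div_const 2).add
      ((hasDerivAt_id (0 : ℝ)).mul_const c)
  have hzero := hφ.hasDerivAt_eq_zero hderiv
  rw [zero_smul, add_zero, add_zero, one_mul] at hzero
  field_simp at hzero
  linarith

variable [FiniteDimensional ℝ X]

theorem continuous_infDist_flagBase :
    Continuous fun z : flagBase (C : Set X) j × X => Metric.infDist z.2 z.1.1.carrier := by
  rw [continuous_iff_continuousAt]
  rintro ⟨y, x⟩
  exact ContinuousAt.comp (x := (y, x)) (f := fun z : flagBase (C : Set X) j × X => (z.1.1, z.2))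
    (ClosedSubsets.continuousAt_infDist y.1 (flagBase_nonempty y) x)
    (by fun_prop : Continuous fun z : flagBase (C : Set X) j × X => (z.1.1, z.2)).continuousAt

/-- A point of the face `y.1.carrier` nearest to `x`. -/
noncomputable def nearest (z : flagBase (C : Set X) j × X) : X :=
  (z.1.1.isClosed_carrier.exists_infDist_eq_dist (flagBase_nonempty z.1) z.2).choose

theorem nearest_mem (z : flagBase (C : Set X) j × X) : nearest z ∈ z.1.1.carrier :=
  (z.1.1.isClosed_carrier.exists_infDist_eq_dist (flagBase_nonempty z.1) z.2).choose_spec.1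

theorem infDist_eq_dist_nearest (z : flagBase (C : Set X) j × X) :
    Metric.infDist z.2 z.1.1.carrier = dist z.2 (nearest z) :=
  (z.1.1.isClosed_carrier.exists_infDist_eq_dist (flagBase_nonempty z.1) z.2).choose_spec.2

theorem continuousAt_nearest {z₀ : flagBase (C : Set X) j × X}
    (huniq : ∀ x ∈ z₀.1.1.carrier, Metric.infDist z₀.2 z₀.1.1.carrier = dist z₀.2 x →
      x = nearest z₀) : ContinuousAt (nearest (C := C) (j := j)) z₀ := by
  refine continuousAt_of_isClosed_relation
    (R := {w : (flagBase (C : Set X) j × X) × X | w.2 ∈ w.1.1.1.carrier} ∩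
      {w | Metric.infDist w.1.2 w.1.1.1.carrier = dist w.1.2 w.2}) ?_
    -- As `0` lies in every face, a nearest point is no farther from `z` than `0` is, so its norm is
    -- at most `2 ‖z‖`.
    (isCompact_closedBall (0 : X) (‖z₀.2‖ + 1 + (‖z₀.2‖ + 1))) ?_ ?_ ?_
  · refine IsClosed.inter ?_ (isClosed_eq ?_ (by fun_prop))
    · exact (ClosedSubsets.isClosed_mem (X := X)).preimage
        (f := fun w : (flagBase (C : Set X) j × X) × X => (w.2, w.1.1.1)) (by fun_prop)
    · exact continuous_infDist_flagBase.comp continuous_fst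
  · have : ∀ᶠ z : flagBase (C : Set X) j × X in 𝓝 z₀, ‖z.2‖ < ‖z₀.2‖ + 1 :=
      ContinuousAt.eventually_lt (by fun_prop) (by fun_prop) (by simp)
    filter_upwards [this] with z hz
    rw [mem_closedBall_zero_iff]
    have h₁ := Metric.infDist_le_dist_of_mem (x := z.2) (flagBase_isFace z.1).zero_mem
    rw [infDist_eq_dist_nearest, dist_zero_right, dist_eq_norm] at h₁
    have h₂ : nearest z = z.2 - (z.2 - nearest z) := by abel
    rw [h₂]
    exact (norm_sub_le _ _).trans (by linarith)
  · exact fun z => ⟨nearest_mem z, infDist_eq_dist_nearest z⟩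
  · rintro x ⟨hx, hx'⟩
    exact huniq x hx hx'

namespace Admissible

variable (h : Admissible C j)
include h

/-- The distance to `E` is strictly minimal at `x₀ - e_F(E)` on the affine subspace parallel to the
half-space. -/
theorem eq_of_norm_le_one (q : flags (C : Set X) j) {x₀ x : X} (hx₀ : x₀ ∈ q.1.2.carrier)
    (hx : x ∈ q.1.1.carrier) {τ : X} (hτ : τ ∈ halfSpace q.1.1.carrier q.1.2.carrier)
    (hle : ‖x - (x₀ - gen q + τ)‖ ≤ 1) : x = x₀ ∧ τ = 0 := by
  obtain ⟨-, hτ₂, hτ₃⟩ := (h.mem_halfSpace q).1 hτ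
  -- This pairing is at least `1`, while the vector has norm at most `1`. Equality in Cauchy–Schwarz
  -- forces the vector to be `gen q` and `x ∈ F`; then `τ = x - x₀` lies in `⟨F⟩ ∩ F^⊥ = 0`.
  have h₁ : ⟪x - (x₀ - gen q + τ), gen q⟫ = ⟪x, gen q⟫ + 1 := by
    rw [inner_sub_left, inner_add_left, inner_sub_left, h.inner_gen_eq_zero q hx₀,
      real_inner_self_eq_norm_sq, h.norm_gen, real_inner_comm _ τ, hτ₃]
    ring
  have h₂ := h.gen_inner_nonneg q hx
  have h₃ := real_inner_le_norm (x - (x₀ - gen q + τ)) (gen q)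
  rw [h.norm_gen, mul_one] at h₃
  have h₄ : ‖x - (x₀ - gen q + τ)‖ = 1 := by linarith
  have h₅ : ⟪x, gen q⟫ = 0 := by linarith
  have h₆ : x - (x₀ - gen q + τ) = gen q :=
    (inner_eq_one_iff_of_norm_eq_one (𝕜 := ℝ) h₄ (h.norm_gen q)).1 (by linarith)
  have hxF : x ∈ q.1.2.carrier := by
    rw [h.bot_eq q]
    exact ⟨hx, h₅⟩
  have hτx : τ = x - x₀ := by
    have : x - x₀ - τ = 0 := by
      rw [← sub_eq_zero] at h₆
      rw [← h₆]
      abel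
    exact (sub_eq_zero.1 this).symm
  have hτ0 : τ = 0 := by
    rw [← inner_self_eq_zero (𝕜 := ℝ)]
    refine hτ₂ τ ?_
    rw [hτx]
    exact Submodule.sub_mem _ (Submodule.subset_span hxF) (Submodule.subset_span hx₀)
  exact ⟨by rw [hτ0] at hτx; exact sub_eq_zero.1 hτx.symm, hτ0⟩

omit h in
variable (C j) in
/-- The orthogonal projection of a translate of the point `z` to the linear span of a face. -/
noncomputable def spanTranslate (T : Submodule ℝ X) (z : X) (w : flagBase (C : Set X) j × T) : X :=
  (Submodule.span ℝ w.1.1.carrier).starProjection (z + w.2)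

omit h in
theorem continuous_spanTranslate (T : Submodule ℝ X) (z : X) :
    Continuous (spanTranslate C j T z) :=
  (continuous_starProjection_span (X := X)).comp
    (f := fun w : flagBase (C : Set X) j × T => (topFace w.1, z + (w.2 : X)))
    ((continuous_topFace.comp continuous_fst).prodMk (by fun_prop))

omit h in
theorem continuous_infDist_spanTranslate (T : Submodule ℝ X) (z : X) :
    Continuous fun w => Metric.infDist (spanTranslate C j T z w) w.1.1.carrier :=
  Continuous.comp (f := fun w : flagBase (C : Set X) j × T => (w.1, spanTranslate C j T z w))
    (continuous_infDist_flagBase (C := C) (j := j))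
    (continuous_fst.prodMk (continuous_spanTranslate T z))

section CentralFibre

variable (q : flags (C : Set X) j) {x₀ : X} (hx₀ : x₀ ∈ q.1.2.carrier)
include hx₀

theorem spanTranslate_flagProj (τ : halfSpace q.1.1.carrier q.1.2.carrier) :
    spanTranslate C j _ (x₀ - gen q) (flagProj (C : Set X) j q, τ) = x₀ - gen q + τ :=
  Submodule.starProjection_eq_self_iff.2 (Submodule.add_mem _
    (Submodule.sub_mem _ (Submodule.subset_span (q.2.2.2 hx₀)) (h.gen_mem_span q))
    ((h.mem_halfSpace q).1 τ.2).1)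

theorem one_lt_infDist_spanTranslate {τ : halfSpace q.1.1.carrier q.1.2.carrier} (hτ : τ ≠ 0) :
    1 < Metric.infDist (spanTranslate C j _ (x₀ - gen q) (flagProj (C : Set X) j q, τ))
      q.1.1.carrier := by
  by_contra! hle
  rw [h.spanTranslate_flagProj q hx₀] at hle
  have h₁ := infDist_eq_dist_nearest (flagProj (C : Set X) j q, x₀ - gen q + (τ : X))
  have h₂ := h₁.symm.le.trans hle
  rw [dist_comm, dist_eq_norm] at h₂
  exact hτ (Subtype.ext (h.eq_of_norm_le_one q hx₀
    (nearest_mem (flagProj (C : Set X) j q, x₀ - gen q + (τ : X))) τ.2 h₂).2)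

theorem infDist_sub_gen : Metric.infDist (x₀ - gen q) q.1.1.carrier = 1 := by
  have h₁ : Metric.infDist (x₀ - gen q) q.1.1.carrier ≤ dist (x₀ - gen q) x₀ :=
    Metric.infDist_le_dist_of_mem (q.2.2.2 hx₀)
  have h₂ := infDist_eq_dist_nearest (flagProj (C : Set X) j q, x₀ - gen q)
  have h₃ : dist (x₀ - gen q) x₀ = 1 := by
    rw [dist_eq_norm, sub_sub_cancel_left, norm_neg, h.norm_gen]
  have h₄ := h₂.symm.le.trans (h₁.trans h₃.le)
  rw [dist_comm, dist_eq_norm] at h₄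
  have h₅ := h.eq_of_norm_le_one q hx₀
    (nearest_mem (flagProj (C : Set X) j q, x₀ - gen q)) (Submodule.zero_mem _)
    (by rw [add_zero]; exact h₄)
  refine h₂.trans ?_
  rw [h₅.1]
  exact h₃

theorem eq_of_infDist_sub_gen_eq {x : X} (hx : x ∈ q.1.1.carrier)
    (hxd : Metric.infDist (x₀ - gen q) q.1.1.carrier = dist (x₀ - gen q) x) : x = x₀ := by
  rw [h.infDist_sub_gen q hx₀, dist_comm, dist_eq_norm] at hxd
  exact (h.eq_of_norm_le_one q hx₀ hx (Submodule.zero_mem _)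
    (by rw [add_zero]; exact hxd.symm.le)).1

theorem tendsto_nearest : Tendsto
    (fun w => (w.1, nearest (w.1, spanTranslate C j (halfSpace q.1.1.carrier q.1.2.carrier)
      (x₀ - gen q) w))) (𝓝 (flagProj (C : Set X) j q, 0)) (𝓝 (flagProj (C : Set X) j q, x₀)) := by
  have hval := h.spanTranslate_flagProj q hx₀ 0
  rw [Submodule.coe_zero, add_zero] at hval
  have hnear : nearest (flagProj (C : Set X) j q, x₀ - gen q) = x₀ :=
    h.eq_of_infDist_sub_gen_eq q hx₀ (nearest_mem (flagProj (C : Set X) j q, x₀ - gen q))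
      (infDist_eq_dist_nearest (flagProj (C : Set X) j q, x₀ - gen q))
  have h₁ : Tendsto (nearest (C := C) (j := j)) (𝓝 (flagProj (C : Set X) j q, x₀ - gen q))
      (𝓝 x₀) := by
    have := continuousAt_nearest (z₀ := (flagProj (C : Set X) j q, x₀ - gen q)) fun x hx hxd => by
      rw [hnear]
      exact h.eq_of_infDist_sub_gen_eq q hx₀ hx hxd
    rwa [ContinuousAt, hnear] at this
  have h₂ := (continuous_spanTranslate (C := C) (j := j)
    (halfSpace q.1.1.carrier q.1.2.carrier) (x₀ - gen q)).tendsto (flagProj (C : Set X) j q, 0)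
  rw [hval] at h₂
  have h₃ := (continuous_fst (X := flagBase (C : Set X) j)
    (Y := halfSpace q.1.1.carrier q.1.2.carrier)).tendsto (flagProj (C : Set X) j q, 0)
  exact h₃.prodMk_nhds (h₁.comp (h₃.prodMk_nhds h₂))

end CentralFibre

/-- For points `(y, p)` of `ξ(𝒫_j) × E_{1/2}(F)` near `(E, 0)`, the perturbed distance function
`τ ↦ infDist (z + τ) y + ⟪p, τ⟫` attains its minimum on a small ball at an interior point. -/
theorem eventually_exists_isMinOn (q₀ : flags (C : Set X) j) {x₀ : X} (hx₀ : x₀ ∈ q₀.1.2.carrier)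
    {δ : ℝ} (hδ : 0 < δ) :
    ∀ᶠ w : flagBase (C : Set X) j × halfSpace q₀.1.1.carrier q₀.1.2.carrier in
      𝓝 (flagProj (C : Set X) j q₀, 0), ∃ τ : halfSpace q₀.1.1.carrier q₀.1.2.carrier, ‖τ‖ < δ ∧
        ∀ᶠ τ' in 𝓝 τ,
          Metric.infDist (spanTranslate C j _ (x₀ - gen q₀) (w.1, τ)) w.1.1.carrier +
            ⟪(w.2 : X), (τ : X)⟫ ≤
          Metric.infDist (spanTranslate C j _ (x₀ - gen q₀) (w.1, τ')) w.1.1.carrier +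
            ⟪(w.2 : X), (τ' : X)⟫ := by
  set T := halfSpace q₀.1.1.carrier q₀.1.2.carrier with hT
  set y₀ := flagProj (C : Set X) j q₀ with hy₀
  let G : (flagBase (C : Set X) j × T) × T → ℝ := fun w =>
    Metric.infDist (spanTranslate C j T (x₀ - gen q₀) (w.1.1, w.2)) w.1.1.1.carrier +
      ⟪(w.1.2 : X), (w.2 : X)⟫
  have hG : Continuous G :=
    ((continuous_infDist_spanTranslate T (x₀ - gen q₀)).comp
      (f := fun w : (flagBase (C : Set X) j × T) × T => (w.1.1, w.2)) (by fun_prop)).add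
      (by fun_prop)
  -- At `(E, 0)` the function is `1` at the centre and exceeds `1` on the sphere. By compactness
  -- this gap persists nearby, so a minimum over the closed ball avoids the sphere.
  have hsph : ∀ᶠ w : flagBase (C : Set X) j × T in 𝓝 (y₀, 0),
      ∀ τ ∈ Metric.sphere (0 : T) δ, G (w, 0) < G (w, τ) := by
    refine (isCompact_sphere (0 : T) δ).eventually_forall_of_forall_eventually fun τ hτ => ?_
    have hc : Continuous fun w : (flagBase (C : Set X) j × T) × T => G (w.1, 0) :=
      hG.comp (by fun_prop)
    refine hc.continuousAt.eventually_lt hG.continuousAt ?_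
    have hτ0 : τ ≠ 0 := by
      rw [← norm_ne_zero_iff, mem_sphere_zero_iff_norm.1 hτ]
      exact hδ.ne'
    have h₁ : G ((y₀, 0), 0) = 1 := by
      have := h.spanTranslate_flagProj q₀ hx₀ 0
      simp only [G]
      rw [this, Submodule.coe_zero, add_zero, inner_zero_left, add_zero]
      exact h.infDist_sub_gen q₀ hx₀
    have h₂ : 1 < G ((y₀, 0), τ) := by
      simp only [G]
      rw [Submodule.coe_zero, inner_zero_left, add_zero]
      exact h.one_lt_infDist_spanTranslate q₀ hx₀ hτ0
    exact h₁.trans_lt h₂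
  filter_upwards [hsph] with w hmin
  have hGw : Continuous fun τ : T => G (w, τ) := hG.comp (by fun_prop)
  obtain ⟨τ, hτ, hτmin⟩ := (isCompact_closedBall (0 : T) δ).exists_isMinOn
    ⟨0, Metric.mem_closedBall_self hδ.le⟩ hGw.continuousOn
  have hτlt : ‖τ‖ < δ := by
    refine lt_of_le_of_ne (mem_closedBall_zero_iff.1 hτ) fun heq => ?_
    exact lt_irrefl _ ((hmin τ (mem_sphere_zero_iff_norm.2 heq)).trans_le
      (hτmin (Metric.mem_closedBall_self hδ.le)))
  refine ⟨τ, hτlt, ?_⟩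
  filter_upwards [Metric.isOpen_ball.mem_nhds (mem_ball_zero_iff.2 hτlt)] with τ' hτ'
  exact hτmin (Metric.ball_subset_closedBall hτ')

/-- The orthogonal projections of the generators of the relative dual faces to the half-space of a
flag fill a neighbourhood of zero, locally uniformly over the base. -/
theorem eventually_exists_starProjection_eq (q₀ : flags (C : Set X) j)
    {N : Set (flags (C : Set X) j)} (hN : N ∈ 𝓝 q₀) :
    ∀ᶠ w : flagBase (C : Set X) j × halfSpace q₀.1.1.carrier q₀.1.2.carrier in
      𝓝 (flagProj (C : Set X) j q₀, 0), ∃ q ∈ N, flagProj (C : Set X) j q = w.1 ∧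
        (halfSpace q₀.1.1.carrier q₀.1.2.carrier).starProjection (gen q) = w.2 := by
  obtain ⟨x₀, hx₀⟩ := (isFace_bot q₀).exists_mem_intrinsicInterior
  have hx₀F := intrinsicInterior_subset hx₀
  have hval := h.spanTranslate_flagProj q₀ hx₀F 0
  rw [Submodule.coe_zero, add_zero] at hval
  have hpos : ∀ᶠ w in 𝓝 (flagProj (C : Set X) j q₀, 0),
      0 < Metric.infDist (spanTranslate C j (halfSpace q₀.1.1.carrier q₀.1.2.carrier)
        (x₀ - gen q₀) w) w.1.1.carrier := by
    refine (continuous_infDist_spanTranslate _ _).continuousAt.eventually_const_lt ?_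
    dsimp only
    rw [hval]
    exact one_pos.trans_eq (h.infDist_sub_gen q₀ hx₀F).symm
  have hev := ((h.tendsto_nearest q₀ hx₀F).eventually
    (h.eventually_exists_flag q₀ hx₀ hN)).and hpos
  rw [nhds_prod_eq, eventually_iff, mem_prod_iff] at hev
  obtain ⟨A, hA, V, hV, hAV⟩ := hev
  obtain ⟨δ, hδ, hδV⟩ := Metric.nhds_basis_ball.mem_iff.1 hV
  have hA' : ∀ᶠ w : flagBase (C : Set X) j × halfSpace q₀.1.1.carrier q₀.1.2.carrier in
      𝓝 (flagProj (C : Set X) j q₀, 0), w.1 ∈ A :=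
    (continuous_fst.tendsto (flagProj (C : Set X) j q₀, _)).eventually hA
  filter_upwards [h.eventually_exists_isMinOn q₀ hx₀F hδ, hA']
  rintro ⟨y, p⟩ ⟨τ, hτ, hmin⟩ hyA
  obtain ⟨hK, hpos⟩ := hAV (mk_mem_prod hyA (hδV (mem_ball_zero_iff.2 hτ)))
  dsimp only at hK hpos hmin
  set z := spanTranslate C j _ (x₀ - gen q₀) (y, τ) with hz
  set x := nearest (y, z) with hx
  have hxE : x ∈ y.1.carrier := nearest_mem (y, z)
  have hxz : Metric.infDist z y.1.carrier = dist z x := infDist_eq_dist_nearest (y, z)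
  -- This is why translates are projected to the span of the nearby face: the residual `x - z` then
  -- lies in its relative dual cone.
  have hzs : z ∈ Submodule.span ℝ y.1.carrier := Submodule.starProjection_apply_mem _ _
  obtain ⟨hf₁, hf₂⟩ := (flagBase_isFace y).inner_sub_nearest hxE hxz
  have hr : 0 < ‖z - x‖ := by
    rw [← dist_eq_norm, ← hxz]
    exact hpos
  have hf0 : x - z ≠ 0 := by
    rw [← norm_pos_iff, norm_sub_rev]
    exact hr
  obtain ⟨q, hqN, hqy, hqf⟩ := hK hxE (x - z)
    (mem_relDual.2 ⟨hf₁, Submodule.sub_mem _ (Submodule.subset_span hxE) hzs⟩) hf0 hf₂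
  refine ⟨q, hqN, hqy, Submodule.eq_starProjection_of_mem_of_inner_eq_zero p.2 fun v hv => ?_⟩
  set w := (Submodule.span ℝ y.1.carrier).starProjection v with hw
  -- Stationarity of the minimum along `v`. Together with `gen q = (x - z) / ‖x - z‖` it says `⟪gen
  -- q, v⟫ = ⟪p, v⟫`.
  have hfirst : ⟪z - x, w⟫ = -(‖z - x‖ * ⟪(p : X), v⟫) := by
    refine inner_eq_of_eventually_norm_le (norm_pos_iff.1 hr) ?_
    have hline : Tendsto (fun s : ℝ => τ + s • (⟨v, hv⟩ : halfSpace q₀.1.1.carrier q₀.1.2.carrier))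
        (𝓝 0) (𝓝 τ) := by
      have : Continuous fun s : ℝ =>
          τ + s • (⟨v, hv⟩ : halfSpace q₀.1.1.carrier q₀.1.2.carrier) := by fun_prop
      simpa using this.tendsto 0
    filter_upwards [hline.eventually hmin] with s hs
    have h₁ : spanTranslate C j _ (x₀ - gen q₀)
        (y, τ + s • (⟨v, hv⟩ : halfSpace q₀.1.1.carrier q₀.1.2.carrier)) = z + s • w := by
      rw [hz, hw, spanTranslate, spanTranslate, ← map_smul, ← map_add]
      congr 1
      simp [add_assoc]
    -- Keeping `x` fixed as competitor bounds the distance above, with equality at `s = 0`; the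
    -- distance function itself need not be differentiated.
    have h₂ : Metric.infDist (z + s • w) y.1.carrier ≤ ‖(z - x) + s • w‖ := by
      refine (Metric.infDist_le_dist_of_mem hxE).trans_eq ?_
      rw [dist_eq_norm]
      congr 1
      abel
    rw [h₁, hxz, dist_eq_norm, Submodule.coe_add, Submodule.coe_smul, inner_add_right,
      real_inner_smul_right] at hs
    linarith
  have hgen : ⟪gen q, v⟫ = ⟪gen q, w⟫ := by
    have hmem : gen q ∈ Submodule.span ℝ y.1.carrier := hqy ▸ h.gen_mem_span q
    rw [hw, ← Submodule.inner_starProjection_left_eq_right,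
      Submodule.starProjection_eq_self_iff.2 hmem]
  rw [inner_sub_left, hgen, hqf, real_inner_smul_left, norm_sub_rev, ← neg_sub z x,
    inner_neg_left, hfirst, neg_neg, inv_mul_cancel_left₀ hr.ne', sub_self]

end Admissible

end ConeFace

/-! ### Calculus of class `C^{1,0}` and compatibility of induced charts. -/

namespace FibrewiseC1

open Topology Filter Set

section Criterion

variable {Y V W : Type*} [TopologicalSpace Y] [NormedAddCommGroup V] [NormedSpace ℝ V]
  [NormedAddCommGroup W] [NormedSpace ℝ W]

theorem IsC10On.mono {f : Y × V → W} {A B : Set (Y × V)} (hf : IsC10On f A) (hBA : B ⊆ A) :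
    IsC10On f B :=
  ⟨hf.1.mono hBA, fun U V' hU hV' h => hf.2 U V' hU hV' (h.trans hBA)⟩

omit [NormedSpace ℝ V] in
theorem tendstoUniformlyOn_of_continuousOn {Z : Type*} [PseudoMetricSpace Z] {g : Y × V → Z}
    {A : Set (Y × V)} (hA : IsOpen A) (hg : ContinuousOn g A) {y₀ : Y} {K : Set V}
    (hK : IsCompact K) (hKA : ∀ v ∈ K, (y₀, v) ∈ A) :
    TendstoUniformlyOn (fun y v => g (y, v)) (fun v => g (y₀, v)) (𝓝 y₀) K := by
  rw [Metric.tendstoUniformlyOn_iff]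
  intro ε hε
  refine hK.eventually_forall_of_forall_eventually fun v hv => ?_
  have hgc : ContinuousAt g (y₀, v) := hg.continuousAt (hA.mem_nhds (hKA v hv))
  have h₁ : ContinuousAt (fun z : Y × V => g (y₀, z.2)) (y₀, v) :=
    ContinuousAt.comp (f := fun z : Y × V => (y₀, z.2)) hgc (by fun_prop)
  refine (h₁.dist hgc).eventually_lt continuousAt_const ?_
  rw [dist_self]
  exact hε

/-- A fibrewise differentiable map with jointly continuous fibrewise derivative is of class
`C^{1,0}`. -/
theorem isC10On_of_hasFDerivAt {f : Y × V → W} {A : Set (Y × V)} (hA : IsOpen A)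
    (hf : ContinuousOn f A) {f' : Y × V → V →L[ℝ] W} (hf' : ContinuousOn f' A)
    (hderiv : ∀ z ∈ A, HasFDerivAt (fun v => f (z.1, v)) (f' z) z.2) : IsC10On f A := by
  refine ⟨hf, fun U V' hU hV' hUV => ⟨fun y hy => ?_, fun y₀ hy₀ K hKV hK => ⟨?_, ?_⟩⟩⟩
  · have hmaps : MapsTo (fun v : V => (y, v)) V' A := fun v hv => hUV ⟨hy, hv⟩
    have hcont : ContinuousOn (fderiv ℝ fun v => f (y, v)) V' := by
      refine (hf'.comp (f := fun v : V => (y, v)) (by fun_prop) hmaps).congr fun v hv => ?_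
      exact (hderiv _ (hmaps hv)).fderiv
    refine (contDiffOn_succ_iff_fderiv_of_isOpen (n := 0) hV').2 ⟨fun v hv => ?_, by simp, ?_⟩
    · exact (hderiv _ (hmaps hv)).differentiableAt.differentiableWithinAt
    · exact contDiffOn_zero.2 hcont
  · exact tendstoUniformlyOn_of_continuousOn hA hf hK fun v hv => hUV ⟨hy₀, hKV hv⟩
  · refine tendstoUniformlyOn_of_continuousOn
      (g := fun z => fderiv ℝ (fun w => f (z.1, w)) z.2) hA ?_ hK fun v hv => hUV ⟨hy₀, hKV hv⟩
    exact hf'.congr fun z hz => (hderiv z hz).fderiv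

theorem IsC10On.hasStrictFDerivAt {f : Y × V → W} {A : Set (Y × V)} (hA : IsOpen A)
    (hf : IsC10On f A) {z : Y × V} (hz : z ∈ A) :
    HasStrictFDerivAt (fun v => f (z.1, v)) (fderiv ℝ (fun v => f (z.1, v)) z.2) z.2 := by
  obtain ⟨U, V', hU, hzU, hV', hzV, hUV⟩ := mem_nhds_prod_iff'.1 (hA.mem_nhds hz)
  exact (((hf.2 U V' hU hV' hUV).1 z.1 hzU).contDiffAt (hV'.mem_nhds hzV)).hasStrictFDerivAt
    one_ne_zero

/-- The fibrewise derivative of a map of class `C^{1,0}` is jointly continuous. -/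
theorem IsC10On.continuousOn_fderiv [FiniteDimensional ℝ V] {f : Y × V → W} {A : Set (Y × V)}
    (hA : IsOpen A) (hf : IsC10On f A) :
    ContinuousOn (fun z : Y × V => fderiv ℝ (fun v => f (z.1, v)) z.2) A := by
  rintro ⟨y₀, v₀⟩ hz
  obtain ⟨U, V', hU, hyU, hV', hvV, hUV⟩ := mem_nhds_prod_iff'.1 (hA.mem_nhds hz)
  have := FiniteDimensional.proper ℝ V
  obtain ⟨K, hK, hKV, hKc⟩ := local_compact_nhds (hV'.mem_nhds hvV)
  obtain ⟨hdiff, hunif⟩ := hf.2 U V' hU hV' hUV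
  -- Joint continuity: uniform convergence in `y` on the compact neighbourhood `K`, plus continuity
  -- of the derivative in the fibre over `y₀`.
  have h₁ := Metric.tendstoUniformlyOn_iff.1 (hunif y₀ hyU K hKV hKc).2
  have h₂ : ContinuousAt (fderiv ℝ fun v => f (y₀, v)) v₀ :=
    (((hdiff y₀ hyU).contDiffAt (hV'.mem_nhds hvV)).fderiv_right (m := 0)
      (by simp)).continuousAt
  refine ContinuousAt.continuousWithinAt ?_
  rw [ContinuousAt, Metric.tendsto_nhds]
  intro ε hε
  filter_upwards [(h₁ (ε / 2) (half_pos hε)).prod_nhds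
    ((Metric.tendsto_nhds.1 h₂ (ε / 2) (half_pos hε)).and hK)] with z hz
  obtain ⟨hz₁, hz₂, hz₃⟩ := hz
  have h₃ := hz₁ z.2 hz₃
  rw [dist_comm] at h₃
  exact (dist_triangle _ _ _).trans_lt (by linarith)

end Criterion

/-! ### Left inverses of injective linear maps -/

section LeftInverse

variable {V X : Type*} [NormedAddCommGroup V] [InnerProductSpace ℝ V] [FiniteDimensional ℝ V]
  [NormedAddCommGroup X] [InnerProductSpace ℝ X] [FiniteDimensional ℝ X]

open ContinuousLinearMap in
/-- The Moore-Penrose left inverse of an injective linear map. -/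
noncomputable def leftInv (B : V →L[ℝ] X) : X →L[ℝ] V :=
  Ring.inverse (adjoint B ∘L B) ∘L adjoint B

theorem isUnit_adjoint_comp {B : V →L[ℝ] X} (hB : Function.Injective B) :
    IsUnit (ContinuousLinearMap.adjoint B ∘L B) := by
  have hinj : Function.Injective (ContinuousLinearMap.adjoint B ∘L B) := by
    rw [injective_iff_map_eq_zero]
    intro v hv
    have h₁ : inner ℝ (B v) (B v) = 0 := by
      rw [← ContinuousLinearMap.adjoint_inner_left, ← ContinuousLinearMap.comp_apply, hv,
        inner_zero_left]
    exact (injective_iff_map_eq_zero B).1 hB v (inner_self_eq_zero.1 h₁)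
  let L := (LinearEquiv.ofInjectiveEndo
    (ContinuousLinearMap.adjoint B ∘L B).toLinearMap hinj).toContinuousLinearEquiv
  exact ⟨ContinuousLinearEquiv.toUnit L, by ext v; rfl⟩

theorem leftInv_comp {B : V →L[ℝ] X} (hB : Function.Injective B) :
    leftInv B ∘L B = ContinuousLinearMap.id ℝ V := by
  rw [leftInv, ContinuousLinearMap.comp_assoc]
  exact Ring.inverse_mul_cancel _ (isUnit_adjoint_comp hB)

/-- `B* B` is invertible for injective `B`, and inversion is continuous at units. -/
theorem continuousAt_leftInv {B : V →L[ℝ] X} (hB : Function.Injective B) :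
    ContinuousAt (leftInv (V := V) (X := X)) B := by
  have h₁ : Continuous fun B : V →L[ℝ] X => ContinuousLinearMap.adjoint B :=
    (ContinuousLinearMap.adjoint (𝕜 := ℝ) (E := V) (F := X)).continuous
  have h₂ : Continuous fun B : V →L[ℝ] X => ContinuousLinearMap.adjoint B ∘L B :=
    h₁.clm_comp continuous_id
  obtain ⟨u, hu⟩ := isUnit_adjoint_comp hB
  have h₃ : ContinuousAt Ring.inverse (ContinuousLinearMap.adjoint B ∘L B) := by
    rw [← hu]
    exact NormedRing.inverse_continuousAt u
  exact (ContinuousAt.comp (f := fun B : V →L[ℝ] X => ContinuousLinearMap.adjoint B ∘L B) h₃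
    h₂.continuousAt).clm_comp h₁.continuousAt

end LeftInverse

/-! ### Compatibility of the charts of the induced atlas -/

section Compatibility

variable {Y M X : Type*} [TopologicalSpace Y] [TopologicalSpace M]
  [NormedAddCommGroup X] [InnerProductSpace ℝ X] [FiniteDimensional ℝ X] {k : ℕ} {ι : M → Y × X}
  {φ ψ : OpenPartialHomeomorph M (Y × EuclideanSpace ℝ (Fin k))}

omit [FiniteDimensional ℝ X] in
theorem fst_symm_of_mem_inducedAtlas (hφ : φ ∈ inducedAtlas k ι)
    {z : Y × EuclideanSpace ℝ (Fin k)} (hz : z ∈ φ.target) : (ι (φ.symm z)).1 = z.1 := by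
  rw [← hφ.1 _ (φ.map_target hz), φ.right_inv hz]

omit [FiniteDimensional ℝ X] in
theorem fst_transition (hφ : φ ∈ inducedAtlas k ι) (hψ : ψ ∈ inducedAtlas k ι)
    {z : Y × EuclideanSpace ℝ (Fin k)} (hz : z ∈ (φ.symm.trans ψ).source) :
    ((φ.symm.trans ψ) z).1 = z.1 :=
  (hψ.1 _ hz.2).trans (fst_symm_of_mem_inducedAtlas hφ hz.1)

/-- Composing `ι ∘ ψ⁻¹` with a left inverse of its fibre derivative gives a self-map of `ℝ^k` with
strict derivative the identity, hence locally invertible. The transition is this local inverse after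
the same left inverse applied to `ι ∘ φ⁻¹`, so the chain rule applies. -/
theorem hasFDerivAt_transition (hφ : φ ∈ inducedAtlas k ι) (hψ : ψ ∈ inducedAtlas k ι)
    {z : Y × EuclideanSpace ℝ (Fin k)} (hz : z ∈ (φ.symm.trans ψ).source) :
    HasFDerivAt (fun v => ((φ.symm.trans ψ) (z.1, v)).2)
      (leftInv (fibreDeriv ι ψ ((φ.symm.trans ψ) z)) ∘L fibreDeriv ι φ z) z.2 := by
  set τ := φ.symm.trans ψ with hτ
  have hτz : τ z ∈ ψ.target := ψ.map_source hz.2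
  set B := fibreDeriv ι ψ (τ z) with hB
  have hBinj : Function.Injective B := hψ.2.2 _ hτz
  have hstrict : HasStrictFDerivAt (fun v => leftInv B ((ι (ψ.symm (z.1, v))).2))
      ((ContinuousLinearEquiv.refl ℝ (EuclideanSpace ℝ (Fin k)) :
        EuclideanSpace ℝ (Fin k) →L[ℝ] EuclideanSpace ℝ (Fin k))) (τ z).2 := by
    have h₁ := hψ.2.1.hasStrictFDerivAt ψ.open_target hτz
    rw [fst_transition hφ hψ hz] at h₁
    have h₂ := ((leftInv B).hasStrictFDerivAt (x := (ι (ψ.symm (z.1, (τ z).2))).2)).comp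
      (τ z).2 h₁
    have h₃ : leftInv B ∘L B = ContinuousLinearMap.id ℝ _ := leftInv_comp hBinj
    rw [hB, fibreDeriv, fst_transition hφ hψ hz] at h₃
    rw [hB, fibreDeriv, fst_transition hφ hψ hz] at h₂
    rw [h₃] at h₂
    rw [hB, fibreDeriv, fst_transition hφ hψ hz]
    exact h₂
  have hcont : ContinuousAt (fun v => (τ (z.1, v))) z.2 :=
    ContinuousAt.comp (f := fun v => (z.1, v)) (τ.continuousAt hz) (by fun_prop)
  have hinv := hstrict.to_localInverse.hasFDerivAt
  -- Continuity of the transition keeps its values where the local inverse is valid.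
  have hleft := hcont.snd.eventually hstrict.eventually_left_inverse
  have hsrc : ∀ᶠ v in 𝓝 z.2, (z.1, v) ∈ τ.source :=
    (by fun_prop : Continuous fun v : EuclideanSpace ℝ (Fin k) => (z.1, v)).continuousAt.eventually_mem
      (τ.open_source.mem_nhds hz)
  have hval : ∀ v, (z.1, v) ∈ τ.source →
      (ι (ψ.symm (z.1, (τ (z.1, v)).2))).2 = (ι (φ.symm (z.1, v))).2 := by
    intro v hv
    have h₁ : (z.1, (τ (z.1, v)).2) = τ (z.1, v) :=
      Prod.ext (fst_transition hφ hψ hv).symm rfl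
    rw [h₁]
    congr 2
    exact ψ.left_inv hv.2
  have hφd : HasFDerivAt (fun v => leftInv B ((ι (φ.symm (z.1, v))).2))
      (leftInv B ∘L fibreDeriv ι φ z) z.2 :=
    ((leftInv B).hasFDerivAt).comp z.2 (hφ.2.1.hasStrictFDerivAt φ.open_target hz.1).hasFDerivAt
  have hz' : leftInv B ((ι (ψ.symm (z.1, (τ z).2))).2) = leftInv B ((ι (φ.symm (z.1, z.2))).2) := by
    rw [← hval z.2 hz]
  rw [hz'] at hinv
  have hcomp := hinv.comp z.2 hφd
  rw [ContinuousLinearEquiv.refl_symm, ContinuousLinearEquiv.coe_refl,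
    ContinuousLinearMap.id_comp] at hcomp
  refine hcomp.congr_of_eventuallyEq ?_
  filter_upwards [hleft, hsrc] with v hv hvs
  rw [hval v hvs] at hv
  exact hv.symm

theorem isC10On_transition (hφ : φ ∈ inducedAtlas k ι) (hψ : ψ ∈ inducedAtlas k ι) :
    IsC10On (fun z => ((φ.symm.trans ψ) z).2) (φ.symm.trans ψ).source := by
  refine isC10On_of_hasFDerivAt (φ.symm.trans ψ).open_source
    (continuous_snd.comp_continuousOn (φ.symm.trans ψ).continuousOn) ?_
    fun z hz => hasFDerivAt_transition hφ hψ hz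
  have h₁ : ContinuousOn (fibreDeriv ι φ) (φ.symm.trans ψ).source :=
    (hφ.2.1.continuousOn_fderiv φ.open_target).mono fun z hz => hz.1
  have h₂ : ContinuousOn (fun z => fibreDeriv ι ψ ((φ.symm.trans ψ) z))
      (φ.symm.trans ψ).source :=
    (hψ.2.1.continuousOn_fderiv ψ.open_target).comp (φ.symm.trans ψ).continuousOn
      fun z hz => ψ.map_source hz.2
  refine ContinuousOn.clm_comp (fun z hz => ?_) h₁
  exact ContinuousAt.comp_continuousWithinAt
    (f := fun z => fibreDeriv ι ψ ((φ.symm.trans ψ) z))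
    (continuousAt_leftInv (hψ.2.2 _ (ψ.map_source hz.2))) (h₂ z hz)

theorem isC10Iso_transition (hφ : φ ∈ inducedAtlas k ι) (hψ : ψ ∈ inducedAtlas k ι) :
    IsC10Iso (φ.symm.trans ψ) where
  fst_eq _ hz := fst_transition hφ hψ hz
  c10 := isC10On_transition hφ hψ
  c10_symm := by
    have h := isC10On_transition hψ hφ
    have hsymm : (φ.symm.trans ψ).symm = ψ.symm.trans φ := by
      rw [OpenPartialHomeomorph.trans_symm_eq_symm_trans_symm, OpenPartialHomeomorph.symm_symm]
    rw [← hsymm] at h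
    exact h

end Compatibility

end FibrewiseC1

/-! ### Charts and submanifolds from converging secants. -/

namespace FibrewiseC1

open Topology Filter Set Asymptotics

variable {Y M X : Type*} [TopologicalSpace Y] [TopologicalSpace M]
  [NormedAddCommGroup X] [InnerProductSpace ℝ X] [FiniteDimensional ℝ X]

/-- The coordinates on `M` near `m₀` given by the base point and the orthogonal projection of the
fibre component of `ι` to the subspace `T m₀`. -/
noncomputable def fibreCoord (ι : M → Y × X) (T : M → Submodule ℝ X) (m₀ m : M) : Y × T m₀ :=
  ((ι m).1, (T m₀).orthogonalProjectionOnto (ι m).2)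

/-- A family of subspaces `T m` which depends continuously on `m` and to which the secants of the
fibres of `ι` converge, such that the projections of the image of `ι` to the spaces `T m` are
locally onto. -/
structure HasSecantSpaces (ι : M → Y × X) (T : M → Submodule ℝ X) : Prop where
  continuous : Continuous ι
  injective : Function.Injective ι
  isLittleO_secant : ∀ m₀, (fun z : M × M => (ι z.2).2 - (ι z.1).2 -
    (T m₀).starProjection ((ι z.2).2 - (ι z.1).2))
      =o[𝓝 (m₀, m₀) ⊓ 𝓟 {z | (ι z.1).1 = (ι z.2).1}] fun z => (ι z.2).2 - (ι z.1).2
  eventually_exists : ∀ m₀, ∀ N ∈ 𝓝 m₀, ∀ᶠ w in 𝓝 (fibreCoord ι T m₀ m₀),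
    ∃ m ∈ N, fibreCoord ι T m₀ m = w
  continuous_starProjection : Continuous fun m => (T m).starProjection

/-- An operator which compares two subspaces; it is the identity if the subspaces are equal. -/
noncomputable def comparison (T : M → Submodule ℝ X) (m₀ m : M) : X →L[ℝ] X :=
  1 - (T m).starProjection + (T m₀).starProjection

/-- The fibrewise derivative of the inverse of the chart at `m₀`. -/
noncomputable def secantDeriv (T : M → Submodule ℝ X) (m₀ m : M) : T m₀ →L[ℝ] X :=
  Ring.inverse (comparison T m₀ m) ∘L (T m₀).subtypeL

omit [TopologicalSpace M] in
theorem injective_secantDeriv {T : M → Submodule ℝ X} {m₀ m : M}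
    (hu : IsUnit (comparison T m₀ m)) : Function.Injective (secantDeriv T m₀ m) := by
  intro v v' hv
  have hcancel : ∀ x, comparison T m₀ m (Ring.inverse (comparison T m₀ m) x) = x := fun x =>
    congrArg (fun L : X →L[ℝ] X => L x) (Ring.mul_inverse_cancel _ hu)
  have := congrArg (comparison T m₀ m) hv
  simp only [secantDeriv, ContinuousLinearMap.comp_apply, hcancel] at this
  exact Subtype.ext this

namespace HasSecantSpaces

variable {ι : M → Y × X} {T : M → Submodule ℝ X} (h : HasSecantSpaces ι T)
include h

theorem continuous_fibreCoord (m₀ : M) : Continuous (fibreCoord ι T m₀) :=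
  (continuous_fst.comp h.continuous).prodMk
    ((T m₀).orthogonalProjectionOnto.continuous.comp (continuous_snd.comp h.continuous))

theorem continuous_comparison (m₀ : M) : Continuous (comparison T m₀) :=
  (continuous_const.sub h.continuous_starProjection).add continuous_const

/-- Once the component of a secant off `T m₀` is at most half its length, the projection controls
the whole secant. This gives injectivity of the coordinates and the Lipschitz bound on their
inverse. -/
theorem exists_mem_nhds_norm_le (m₀ : M) : ∃ N ∈ 𝓝 m₀, ∀ m ∈ N, ∀ m' ∈ N, (ι m).1 = (ι m').1 →
    ‖(ι m').2 - (ι m).2‖ ≤ 2 * ‖(T m₀).starProjection ((ι m').2 - (ι m).2)‖ := by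
  have h₁ := (isLittleO_iff.1 (h.isLittleO_secant m₀)) (one_half_pos (α := ℝ))
  rw [eventually_inf_principal, nhds_prod_eq, eventually_iff, mem_prod_same_iff] at h₁
  obtain ⟨N, hN, hNm⟩ := h₁
  refine ⟨N, hN, fun m hm m' hm' heq => ?_⟩
  have h₂ := hNm (mk_mem_prod hm hm') heq
  have h₃ := norm_add_le ((ι m').2 - (ι m).2 - (T m₀).starProjection ((ι m').2 - (ι m).2))
    ((T m₀).starProjection ((ι m').2 - (ι m).2))
  rw [sub_add_cancel] at h₃
  dsimp only at h₂
  linarith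

theorem exists_isCompact [LocallyCompactSpace M] (m₀ : M) : ∃ K ∈ 𝓝 m₀, IsCompact K ∧
    (∀ m ∈ K, ∀ m' ∈ K, (ι m).1 = (ι m').1 →
      ‖(ι m').2 - (ι m).2‖ ≤ 2 * ‖(T m₀).starProjection ((ι m').2 - (ι m).2)‖) ∧
    ∀ m ∈ K, IsUnit (comparison T m₀ m) := by
  obtain ⟨N, hN, hNm⟩ := h.exists_mem_nhds_norm_le m₀
  have hunit : ∀ᶠ m in 𝓝 m₀, IsUnit (comparison T m₀ m) := by
    refine (h.continuous_comparison m₀).continuousAt.eventually_mem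
      (Units.isOpen.mem_nhds (?_ : IsUnit (comparison T m₀ m₀)))
    rw [comparison, sub_add_cancel]
    exact isUnit_one
  obtain ⟨K, hK, hKN, hKc⟩ := local_compact_nhds (inter_mem hN hunit)
  exact ⟨K, hK, hKc, fun m hm m' hm' => hNm m (hKN hm).1 m' (hKN hm').1, fun m hm => (hKN hm).2⟩

theorem injOn_fibreCoord {m₀ : M} {K : Set M}
    (hK : ∀ m ∈ K, ∀ m' ∈ K, (ι m).1 = (ι m').1 →
      ‖(ι m').2 - (ι m).2‖ ≤ 2 * ‖(T m₀).starProjection ((ι m').2 - (ι m).2)‖) :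
    InjOn (fibreCoord ι T m₀) K := by
  intro m hm m' hm' heq
  have h₁ : (ι m).1 = (ι m').1 := congrArg (fun z => z.1) heq
  have h₂ : (T m₀).starProjection (ι m).2 = (T m₀).starProjection (ι m').2 :=
    congrArg (fun z => (z.2 : X)) heq
  have h₃ := hK m hm m' hm' h₁
  rw [map_sub, h₂, sub_self, norm_zero, mul_zero, norm_le_zero_iff, sub_eq_zero] at h₃
  exact h.injective (Prod.ext h₁ h₃.symm)

/-- The coordinates `fibreCoord` define a chart. -/
theorem exists_chart [T2Space M] [LocallyCompactSpace M] [T2Space Y] (m₀ : M) :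
    ∃ c : OpenPartialHomeomorph M (Y × T m₀), m₀ ∈ c.source ∧ (∀ m, c m = fibreCoord ι T m₀ m) ∧
      (∀ m ∈ c.source, ∀ m' ∈ c.source, (ι m).1 = (ι m').1 →
        ‖(ι m').2 - (ι m).2‖ ≤ 2 * ‖(T m₀).starProjection ((ι m').2 - (ι m).2)‖) ∧
      ∀ m ∈ c.source, IsUnit (comparison T m₀ m) := by
  obtain ⟨K, hK, hKc, hKm, hKu⟩ := h.exists_isCompact m₀
  have hinj := h.injOn_fibreCoord hKm
  have hcont := h.continuous_fibreCoord m₀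
  let c := fibreCoord ι T m₀
  -- Openness of the coordinate map is known only at `m₀`, so the target is cut down to the interior
  -- of the image.
  let W := interior (c '' interior K)
  have hWsub : W ⊆ c '' interior K := interior_subset
  have hKsub : interior K ⊆ K := interior_subset
  have hWm₀ : c m₀ ∈ W := mem_interior_iff_mem_nhds.2
    (h.eventually_exists m₀ _ (interior_mem_nhds.2 hK))
  have hne : Nonempty M := ⟨m₀⟩
  let g := Function.invFunOn c (interior K)
  have hgK : ∀ w ∈ W, g w ∈ interior K := fun w hw =>
    Function.invFunOn_mem (hWsub hw)
  have hcg : ∀ w ∈ W, c (g w) = w := fun w hw =>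
    Function.invFunOn_eq (hWsub hw)
  have hgcont : ContinuousOn g W := by
    rw [continuousOn_iff_continuous_domRestrict, continuous_iff_continuousAt]
    intro w
    -- The inverse is continuous because `c` is continuous and injective on the compact set `K`.
    refine continuousAt_of_isClosed_relation (R := {z : W × M | z.2 ∈ K} ∩ {z | c z.2 = z.1}) ?_
      hKc (Eventually.of_forall fun w => hKsub (hgK w w.2))
      (fun w => ⟨hKsub (hgK w w.2), hcg w w.2⟩) ?_
    · exact (hKc.isClosed.preimage continuous_snd).inter
        (isClosed_eq (hcont.comp continuous_snd) (by fun_prop))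
    · rintro m ⟨hm, hmw⟩
      refine hinj hm (hKsub (hgK w w.2)) ?_
      exact hmw.trans (hcg w w.2).symm
  refine ⟨{ toFun := c, invFun := g, source := interior K ∩ c ⁻¹' W, target := W,
            map_source' := fun m hm => hm.2
            map_target' := fun w hw => ⟨hgK w hw, by rw [mem_preimage, hcg w hw]; exact hw⟩
            left_inv' := fun m hm => hinj (hKsub (hgK _ hm.2)) (interior_subset hm.1)
              (hcg _ hm.2)
            right_inv' := fun w hw => hcg w hw
            continuousOn_toFun := hcont.continuousOn
            continuousOn_invFun := hgcont
            open_source := isOpen_interior.inter (isOpen_interior.preimage hcont)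
            open_target := isOpen_interior }, ⟨mem_interior_iff_mem_nhds.2 hK, hWm₀⟩,
    fun _ => rfl, fun m hm m' hm' => hKm m (interior_subset hm.1) m' (interior_subset hm'.1),
    fun m hm => hKu m (interior_subset hm.1)⟩

section Chart

variable {m₀ : M} {c : OpenPartialHomeomorph M (Y × T m₀)}
  (hc : ∀ m, c m = fibreCoord ι T m₀ m)
include hc

omit h in
theorem fst_symm_chart {w : Y × T m₀} (hw : w ∈ c.target) : (ι (c.symm w)).1 = w.1 := by
  have := c.right_inv hw
  rw [hc] at this
  exact congrArg Prod.fst this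

omit h in
theorem starProjection_symm_chart {w : Y × T m₀} (hw : w ∈ c.target) :
    (T m₀).starProjection (ι (c.symm w)).2 = w.2 := by
  have := c.right_inv hw
  rw [hc] at this
  exact congrArg (fun z => (z.2 : X)) this

/-- For a secant `s` from `m`, `s - P_m s = o(s)`, where `P_m` projects to `T m`, while the
projection of `s` to `T m₀` is exactly the coordinate increment. Hence `comparison` sends `s` to the
increment up to `o(s)`, and inverting it gives the derivative; `hbound` turns `o(s)` into `o` of the
increment. -/
theorem hasFDerivAt_chart
    (hbound : ∀ m ∈ c.source, ∀ m' ∈ c.source, (ι m).1 = (ι m').1 →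
      ‖(ι m').2 - (ι m).2‖ ≤ 2 * ‖(T m₀).starProjection ((ι m').2 - (ι m).2)‖)
    (hunit : ∀ m ∈ c.source, IsUnit (comparison T m₀ m)) {w : Y × T m₀} (hw : w ∈ c.target) :
    HasFDerivAt (fun p => (ι (c.symm (w.1, p))).2) (secantDeriv T m₀ (c.symm w)) w.2 := by
  set m := c.symm w with hm
  have hmem : ∀ᶠ p in 𝓝 w.2, (w.1, p) ∈ c.target :=
    (by fun_prop : Continuous fun p : T m₀ => (w.1, p)).continuousAt.eventually_mem
      (c.open_target.mem_nhds hw)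
  have htend : Tendsto (fun p => (m, c.symm (w.1, p))) (𝓝 w.2)
      (𝓝 (m, m) ⊓ 𝓟 {z | (ι z.1).1 = (ι z.2).1}) := by
    refine tendsto_inf.2 ⟨?_, tendsto_principal.2 ?_⟩
    · refine tendsto_const_nhds.prodMk_nhds ?_
      exact ContinuousAt.comp (f := fun p : T m₀ => (w.1, p)) (c.symm.continuousAt hw)
        (by fun_prop)
    · filter_upwards [hmem] with p hp
      exact (fst_symm_chart hc hw).trans (fst_symm_chart hc hp).symm
  have hlittle := (h.isLittleO_secant m).comp_tendsto htend
  have hproj : ∀ p, (w.1, p) ∈ c.target →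
      (T m₀).starProjection ((ι (c.symm (w.1, p))).2 - (ι m).2) = ((p - w.2 : T m₀) : X) := by
    intro p hp
    rw [map_sub, starProjection_symm_chart hc hp, starProjection_symm_chart hc hw]
    rfl
  have hbig : (fun p => (ι (c.symm (w.1, p))).2 - (ι m).2) =O[𝓝 w.2] fun p => p - w.2 := by
    refine IsBigO.of_bound 2 ?_
    filter_upwards [hmem] with p hp
    have := hbound m (c.map_target hw) _ (c.map_target hp)
      (by rw [fst_symm_chart hc hw, fst_symm_chart hc hp])
    rwa [hproj p hp] at this
  rw [hasFDerivAt_iff_isLittleO]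
  have hlin := ((Ring.inverse (comparison T m₀ m)).isBigO_comp _ (𝓝 w.2)).trans_isLittleO
    (hlittle.trans_isBigO hbig)
  refine hlin.congr' ?_ EventuallyEq.rfl
  filter_upwards [hmem] with p hp
  have hcancel : ∀ x, Ring.inverse (comparison T m₀ m) (comparison T m₀ m x) = x := fun x =>
    congrArg (fun L : X →L[ℝ] X => L x)
      (Ring.inverse_mul_cancel _ (hunit m (c.map_target hw)))
  have hcomp : (ι (c.symm (w.1, p))).2 - (ι m).2 -
      (T m).starProjection ((ι (c.symm (w.1, p))).2 - (ι m).2) =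
      comparison T m₀ m ((ι (c.symm (w.1, p))).2 - (ι m).2) - ((p - w.2 : T m₀) : X) := by
    rw [comparison, _root_.add_apply, _root_.sub_apply, hproj p hp,
      add_sub_cancel_right]
    rfl
  simp only [Function.comp_apply]
  rw [hcomp, map_sub, hcancel]
  rfl

omit hc in
theorem continuousOn_secantDeriv (hunit : ∀ m ∈ c.source, IsUnit (comparison T m₀ m)) :
    ContinuousOn (fun w => secantDeriv T m₀ (c.symm w)) c.target := by
  intro w hw
  obtain ⟨u, hu⟩ := hunit _ (c.map_target hw)
  have h₁ : ContinuousAt Ring.inverse (comparison T m₀ (c.symm w)) := by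
    rw [← hu]
    exact NormedRing.inverse_continuousAt u
  have h₂ : ContinuousAt (fun w => comparison T m₀ (c.symm w)) w :=
    (h.continuous_comparison m₀).continuousAt.comp (c.symm.continuousAt hw)
  exact ((ContinuousAt.comp (f := fun w => comparison T m₀ (c.symm w)) h₁ h₂).clm_comp
    continuousAt_const).continuousWithinAt

end Chart

variable [T2Space M] [LocallyCompactSpace M] [T2Space Y] {k : ℕ}

theorem exists_mem_inducedAtlas (hk : ∀ m, Module.finrank ℝ (T m) = k) (m₀ : M) :
    ∃ φ ∈ inducedAtlas k ι, m₀ ∈ φ.source := by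
  obtain ⟨c, hm₀, hc, hbound, hunit⟩ := h.exists_chart m₀
  let ℓ : T m₀ ≃L[ℝ] EuclideanSpace ℝ (Fin k) :=
    ContinuousLinearEquiv.ofFinrankEq (by rw [hk, finrank_euclideanSpace_fin])
  let H : Y × T m₀ ≃ₜ Y × EuclideanSpace ℝ (Fin k) :=
    (Homeomorph.refl Y).prodCongr ℓ.toHomeomorph
  let φ := c.transHomeomorph H
  have hmem : ∀ z ∈ φ.target, (z.1, ℓ.symm z.2) ∈ c.target := fun z hz => hz
  have hderiv : ∀ z ∈ φ.target, HasFDerivAt (fun v => (ι (φ.symm (z.1, v))).2)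
      (secantDeriv T m₀ (c.symm (z.1, ℓ.symm z.2)) ∘L
        (ℓ.symm : EuclideanSpace ℝ (Fin k) →L[ℝ] T m₀)) z.2 := fun z hz =>
    HasFDerivAt.comp (g := fun p => (ι (c.symm (z.1, p))).2) z.2
      (h.hasFDerivAt_chart hc hbound hunit (hmem z hz)) ℓ.symm.hasFDerivAt
  refine ⟨φ, ⟨fun m _ => ?_, ?_, fun z hz => ?_⟩, hm₀⟩
  · exact congrArg Prod.fst (hc m)
  · refine isC10On_of_hasFDerivAt φ.open_target ?_ ?_ hderiv
    · exact (continuous_snd.comp h.continuous).comp_continuousOn φ.symm.continuousOn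
    · refine ContinuousOn.clm_comp ?_ continuousOn_const
      exact (h.continuousOn_secantDeriv hunit).comp
        (f := fun z : Y × EuclideanSpace ℝ (Fin k) => (z.1, ℓ.symm z.2)) (by fun_prop) hmem
  · rw [fibreDeriv, (hderiv z hz).fderiv]
    exact (injective_secantDeriv (hunit _ (c.map_target (hmem z hz)))).comp ℓ.symm.injective

/-- The image of `ι` is a submanifold. -/
theorem isC10Submanifold [CompactSpace M] (hk : ∀ m, Module.finrank ℝ (T m) = k) :
    IsC10Submanifold k (range ι) := by
  rintro _ ⟨m₀, rfl⟩
  obtain ⟨c, hm₀, hc, hbound, hunit⟩ := h.exists_chart m₀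
  have hemb : IsEmbedding ι := (h.continuous.isClosedEmbedding h.injective).isEmbedding
  -- Restricting to `O` excludes points of the image that come from outside the chart.
  obtain ⟨O, hO, hOc⟩ := hemb.isInducing.isOpen_iff.1 c.open_source
  let T₀ := T m₀
  let pr : Y × X → Y × T₀ := fun z => (z.1, T₀.orthogonalProjectionOnto z.2)
  have hpr : Continuous pr := by fun_prop
  -- The image is locally the graph of `σ`, whose values lie in `T₀^⊥`. Subtracting `σ ∘ pr` is a
  -- shear that preserves `pr` and flattens the graph to `Y × T₀`.
  let σ : Y × T₀ → X := fun w => (ι (c.symm w)).2 - w.2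
  have hσ : ContinuousOn σ c.target :=
    ((continuous_snd.comp h.continuous).comp_continuousOn c.symm.continuousOn).sub (by fun_prop)
  have hσ0 : ∀ w ∈ c.target, T₀.orthogonalProjectionOnto (σ w) = 0 := fun w hw => by
    ext
    rw [Submodule.coe_orthogonalProjectionOnto_apply, map_sub, starProjection_symm_chart hc hw,
      Submodule.starProjection_eq_self_iff.2 w.2.2, sub_self, Submodule.coe_zero]
  have hopen : IsOpen (pr ⁻¹' c.target) := c.open_target.preimage hpr
  have hσpr : ContinuousOn (fun z => σ (pr z)) (pr ⁻¹' c.target) :=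
    hσ.comp hpr.continuousOn fun z hz => hz
  have hsub : ∀ z ∈ pr ⁻¹' c.target, pr (z.1, z.2 - σ (pr z)) = pr z := fun z hz => by
    simp only [pr, map_sub]
    rw [hσ0 _ hz, sub_zero]
  have hadd : ∀ z ∈ pr ⁻¹' c.target, pr (z.1, z.2 + σ (pr z)) = pr z := fun z hz => by
    simp only [pr, map_add]
    rw [hσ0 _ hz, add_zero]
  let Φ : OpenPartialHomeomorph (Y × X) (Y × X) :=
    { toFun := fun z => (z.1, z.2 - σ (pr z)), invFun := fun z => (z.1, z.2 + σ (pr z))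
      source := pr ⁻¹' c.target, target := pr ⁻¹' c.target
      map_source' := fun z hz => by rw [mem_preimage, hsub z hz]; exact hz
      map_target' := fun z hz => by rw [mem_preimage, hadd z hz]; exact hz
      left_inv' := fun z hz => by rw [hsub z hz]; exact Prod.ext rfl (sub_add_cancel _ _)
      right_inv' := fun z hz => by rw [hadd z hz]; exact Prod.ext rfl (add_sub_cancel_right _ _)
      continuousOn_toFun := continuousOn_fst.prodMk (continuousOn_snd.sub hσpr)
      continuousOn_invFun := continuousOn_fst.prodMk (continuousOn_snd.add hσpr)
      open_source := hopen
      open_target := hopen }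
  let D : Y × X → X →L[ℝ] X := fun z =>
    (secantDeriv T m₀ (c.symm (pr z)) - T₀.subtypeL) ∘L T₀.orthogonalProjectionOnto
  have hD : ContinuousOn D (pr ⁻¹' c.target) := by
    refine ContinuousOn.clm_comp (ContinuousOn.sub ?_ continuousOn_const) continuousOn_const
    exact (h.continuousOn_secantDeriv hunit).comp hpr.continuousOn fun z hz => hz
  have hderiv : ∀ z ∈ pr ⁻¹' c.target, HasFDerivAt (fun v => σ (pr (z.1, v))) (D z) z.2 := by
    intro z hz
    have h₁ : HasFDerivAt (fun p => σ (z.1, p))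
        (secantDeriv T m₀ (c.symm (pr z)) - T₀.subtypeL) (pr z).2 :=
      (h.hasFDerivAt_chart hc hbound hunit hz).sub T₀.subtypeL.hasFDerivAt
    exact HasFDerivAt.comp (g := fun p => σ (z.1, p)) z.2 h₁
      T₀.orthogonalProjectionOnto.hasFDerivAt
  have h₁ : IsC10On (fun z => (Φ z).2) (pr ⁻¹' c.target) :=
    isC10On_of_hasFDerivAt hopen (continuousOn_snd.sub hσpr) (continuousOn_const.sub hD)
      fun z hz => (hasFDerivAt_id z.2).sub (hderiv z hz)
  have h₂ : IsC10On (fun z => (Φ.symm z).2) (pr ⁻¹' c.target) :=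
    isC10On_of_hasFDerivAt hopen (continuousOn_snd.add hσpr) (continuousOn_const.add hD)
      fun z hz => (hasFDerivAt_id z.2).add (hderiv z hz)
  have hprι : ∀ m, pr (ι m) = c m := fun m => (hc m).symm
  refine ⟨Φ.restrOpen O hO, T₀, ⟨fun z _ => rfl, h₁.mono ?_, h₂.mono ?_⟩, ?_, hk m₀, ?_⟩
  · rw [OpenPartialHomeomorph.restrOpen_source]
    exact inter_subset_left
  · exact inter_subset_left
  · rw [OpenPartialHomeomorph.restrOpen_source]
    refine ⟨?_, ?_⟩
    · change pr (ι m₀) ∈ c.target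
      rw [hprι]
      exact c.map_source hm₀
    · change m₀ ∈ ι ⁻¹' O
      rw [hOc]
      exact hm₀
  · rintro z hz
    rw [OpenPartialHomeomorph.restrOpen_source] at hz
    obtain ⟨hzc, hzO⟩ := hz
    change z ∈ range ι ↔ z.2 - σ (pr z) ∈ T₀
    have hval : z.2 - σ (pr z) = T₀.orthogonalProjectionOnto z.2 ↔ z = ι (c.symm (pr z)) := by
      constructor
      · intro heq
        refine Prod.ext (fst_symm_chart hc hzc).symm ?_
        rw [sub_eq_iff_eq_add] at heq
        rw [heq]
        exact add_sub_cancel _ _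
      · intro heq
        have : z.2 = (ι (c.symm (pr z))).2 := congrArg Prod.snd heq
        rw [sub_eq_iff_eq_add]
        refine this.trans ?_
        exact (add_sub_cancel _ _).symm
    constructor
    · rintro ⟨m, rfl⟩
      have hm : m ∈ c.source := hOc ▸ hzO
      rw [hval.2 (by rw [hprι, c.left_inv hm])]
      exact Submodule.coe_mem _
    · intro hmem
      refine ⟨c.symm (pr z), (hval.1 ?_).symm⟩
      have h₃ := congrArg (fun w : Y × T₀ => (w.2 : X)) (hsub z hzc)
      exact (Submodule.starProjection_eq_self_iff.2 hmem).symm.trans h₃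

omit [T2Space M] [LocallyCompactSpace M] [T2Space Y] in
-- Hold the projected coordinate fixed and vary the base point: local surjectivity supplies
-- preimages near `m₀`.
theorem isOpenMap_fst : IsOpenMap fun m => (ι m).1 := by
  rw [isOpenMap_iff_nhds_le]
  intro m₀ s hs
  have h₁ := h.eventually_exists m₀ _ hs
  have h₂ : Tendsto (fun y => (y, (fibreCoord ι T m₀ m₀).2)) (𝓝 (ι m₀).1)
      (𝓝 (fibreCoord ι T m₀ m₀)) :=
    (by fun_prop : Continuous fun y : Y => (y, (fibreCoord ι T m₀ m₀).2)).tendsto _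
  filter_upwards [h₂.eventually h₁] with y hy
  obtain ⟨m, hm, hmy⟩ := hy
  have h₃ : (ι m).1 = y := congrArg (fun w => w.1) hmy
  exact h₃ ▸ hm

end HasSecantSpaces

end FibrewiseC1

/-! ### The flag manifold and its fibrewise tangent spaces. -/

namespace ConeFace

open Topology Filter Set
open scoped RealInnerProductSpace

variable {X : Type*} [NormedAddCommGroup X] [InnerProductSpace ℝ X] [FiniteDimensional ℝ X]
  {C : ProperCone ℝ X} {j : ℕ}

namespace Admissible

variable (h : Admissible C j)
include h

theorem hasSecantSpaces : FibrewiseC1.HasSecantSpaces (flagMap (C : Set X) j)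
    fun q => halfSpace q.1.1.carrier q.1.2.carrier where
  continuous := h.continuous_flagMap
  injective := h.injective_flagMap
  isLittleO_secant := h.isLittleO_secant
  eventually_exists q₀ N hN := by
    -- The generator is orthogonal to its half-space, so the centre of the chart has fibre
    -- coordinate zero.
    have hgen : gen q₀ ∈ (halfSpace q₀.1.1.carrier q₀.1.2.carrier)ᗮ := by
      rw [Submodule.mem_orthogonal']
      exact fun v hv => ((h.mem_halfSpace q₀).1 hv).2.2
    have hzero : FibrewiseC1.fibreCoord (flagMap (C : Set X) j)
        (fun q => halfSpace q.1.1.carrier q.1.2.carrier) q₀ q₀ = (flagProj (C : Set X) j q₀, 0) :=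
      Prod.ext rfl (Subtype.ext ((Submodule.starProjection_apply_eq_zero_iff _).2 hgen))
    rw [hzero]
    filter_upwards [h.eventually_exists_starProjection_eq q₀ hN] with w hw
    obtain ⟨q, hqN, hq₁, hq₂⟩ := hw
    exact ⟨q, hqN, Prod.ext hq₁ (Subtype.ext hq₂)⟩
  continuous_starProjection := h.continuous_starProjection_halfSpace

/-- The fibrewise tangent space of `𝒫_j` at `(E, F)` is `E_{1/2}(F)`. -/
theorem fibreTangentSpace_eq (q : flags (C : Set X) j)
    {φ : OpenPartialHomeomorph (flags (C : Set X) j)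
      (flagBase (C : Set X) j × EuclideanSpace ℝ (Fin (fibreDim (C : Set X) j)))}
    (hφ : φ ∈ FibrewiseC1.inducedAtlas (fibreDim (C : Set X) j) (flagMap (C : Set X) j))
    (hq : q ∈ φ.source) :
    FibrewiseC1.fibreTangentSpace (flagMap (C : Set X) j) φ q =
      halfSpace q.1.1.carrier q.1.2.carrier := by
  have hz : φ q ∈ φ.target := φ.map_source hq
  set D := FibrewiseC1.fibreDeriv (flagMap (C : Set X) j) φ (φ q) with hD
  have hderiv : HasFDerivAt (fun v => gen (φ.symm ((φ q).1, v))) D (φ q).2 :=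
    (hφ.2.1.hasStrictFDerivAt φ.open_target hz).hasFDerivAt
  have hval : gen (φ.symm ((φ q).1, (φ q).2)) = gen q := by
    rw [Prod.mk.eta, φ.left_inv hq]
  have hbase : ∀ᶠ v in 𝓝 (φ q).2, (φ.symm ((φ q).1, v)).1.1 = q.1.1 := by
    have hmem : ∀ᶠ v in 𝓝 (φ q).2, ((φ q).1, v) ∈ φ.target :=
      (by fun_prop : Continuous fun v : EuclideanSpace ℝ (Fin (fibreDim (C : Set X) j)) =>
        ((φ q).1, v)).continuousAt.eventually_mem (φ.open_target.mem_nhds hz)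
    filter_upwards [hmem] with v hv
    have h₁ := FibrewiseC1.fst_symm_of_mem_inducedAtlas hφ hv
    exact congrArg Subtype.val (h₁.trans (hφ.1 q hq))
  have hinner : ∀ x : X, HasFDerivAt (fun v => ⟪x, gen (φ.symm ((φ q).1, v))⟫)
      (innerSL ℝ x ∘L D) (φ q).2 := fun x =>
    (innerSL ℝ x).hasFDerivAt.comp (φ q).2 hderiv
  have hle : D.toLinearMap.range ≤ halfSpace q.1.1.carrier q.1.2.carrier := by
    rintro _ ⟨v, rfl⟩
    rw [h.mem_halfSpace]
    refine ⟨?_, ?_, ?_⟩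
    · rw [← Submodule.orthogonal_orthogonal (Submodule.span ℝ q.1.1.carrier),
        Submodule.mem_orthogonal]
      intro x hx
      have h₁ : HasFDerivAt (fun v => ⟪x, gen (φ.symm ((φ q).1, v))⟫)
          (0 : EuclideanSpace ℝ (Fin (fibreDim (C : Set X) j)) →L[ℝ] ℝ) (φ q).2 := by
        refine (hasFDerivAt_const (0 : ℝ) (φ q).2).congr_of_eventuallyEq ?_
        filter_upwards [hbase] with v hv
        rw [real_inner_comm]
        exact hx _ (hv ▸ h.gen_mem_span (φ.symm ((φ q).1, v)))
      exact congrArg (fun L => L v) ((hinner x).unique h₁)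
    · rw [Submodule.mem_orthogonal]
      intro x hx
      induction hx using Submodule.span_induction with
      | mem x hx =>
        -- Generators over the same `E` are non-negative at `x ∈ F ⊆ E`, and that of `q` vanishes
        -- there.
        have hmin : IsLocalMin (fun v => ⟪x, gen (φ.symm ((φ q).1, v))⟫) (φ q).2 := by
          filter_upwards [hbase] with v hv
          rw [hval, h.inner_gen_eq_zero q hx]
          exact h.gen_inner_nonneg _ (hv ▸ q.2.2.2 hx)
        exact congrArg (fun L => L v) (hmin.hasFDerivAt_eq_zero (hinner x))
      | zero => exact inner_zero_left _
      | add a b _ _ ha hb => rw [inner_add_left, ha, hb, add_zero]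
      | smul t a _ ha => rw [real_inner_smul_left, ha, mul_zero]
    -- Among unit vectors the pairing with `gen q` is largest at `gen q`.
    · have hmax : IsLocalMax (fun v => ⟪gen q, gen (φ.symm ((φ q).1, v))⟫) (φ q).2 := by
        refine Eventually.of_forall fun v => ?_
        dsimp only
        rw [hval, real_inner_self_eq_norm_sq, h.norm_gen]
        refine (real_inner_le_norm _ _).trans ?_
        rw [h.norm_gen, h.norm_gen]
        norm_num
      exact congrArg (fun L => L v) (hmax.hasFDerivAt_eq_zero (hinner (gen q)))
  -- The derivative is injective on `ℝ^k`, and `k` is the dimension of the half-space.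
  refine Submodule.eq_of_le_of_finrank_eq hle ?_
  rw [h.finrank_halfSpace]
  exact (LinearMap.finrank_range_of_inj (hφ.2.2 _ hz)).trans finrank_euclideanSpace_fin

theorem isC10Manifold_product : FibrewiseC1.IsC10Manifold
    (Prod.fst : flagBase (C : Set X) j × X → flagBase (C : Set X) j)
    (FibrewiseC1.productAtlas (flagBase (C : Set X) j) X) :=
  have := h.compactSpace_flagBase
  { t2_total := inferInstance
    locallyCompact_total := inferInstance
    paracompact_total := inferInstance
    t2_base := inferInstance
    locallyCompact_base := inferInstance
    paracompact_base := inferInstance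
    continuous := continuous_fst
    isOpenMap := isOpenMap_fst
    surjective := Prod.fst_surjective
    fst_eq := by
      rintro φ rfl m -
      rfl
    cover := fun m => ⟨_, rfl, mem_univ _⟩
    compatible := by
      rintro φ rfl ψ rfl
      have hsnd : FibrewiseC1.IsC10On (fun z : flagBase (C : Set X) j × X => z.2) univ :=
        FibrewiseC1.isC10On_of_hasFDerivAt isOpen_univ continuousOn_snd continuousOn_const
          fun z _ => hasFDerivAt_id z.2
      exact ⟨fun _ _ => rfl, hsnd.mono (subset_univ _), hsnd.mono (subset_univ _)⟩ }

theorem isC10Manifold_flags : FibrewiseC1.IsC10Manifold (flagProj (C : Set X) j)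
    (FibrewiseC1.inducedAtlas (fibreDim (C : Set X) j) (flagMap (C : Set X) j)) :=
  have := h.compactSpace_flags
  have := h.compactSpace_flagBase
  { t2_total := inferInstance
    locallyCompact_total := inferInstance
    paracompact_total := inferInstance
    t2_base := inferInstance
    locallyCompact_base := inferInstance
    paracompact_base := inferInstance
    continuous := continuous_flagProj
    isOpenMap := h.hasSecantSpaces.isOpenMap_fst
    surjective := exists_flag
    fst_eq := fun _ hφ m hm => hφ.1 m hm
    cover := fun q => h.hasSecantSpaces.exists_mem_inducedAtlas h.finrank_halfSpace q
    compatible := fun _ hφ _ hψ => FibrewiseC1.isC10Iso_transition hφ hψ }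

end Admissible

end ConeFace

theorem mainTheorem5 {X : Type*} [NormedAddCommGroup X] [InnerProductSpace ℝ X]
    [FiniteDimensional ℝ X] (Ω : ProperCone ℝ X)
    (hpointed : ∀ x ∈ Ω, -x ∈ Ω → x = 0)
    (hsolid : (interior (Ω : Set X)).Nonempty)
    (hcompact : ConeFace.FaciallyCompact (ConeFace.dualCone Ω))
    (hsmooth : ConeFace.LocallySmooth (ConeFace.dualCone Ω))
    (j : ℕ) (hj : 1 ≤ j) (hjd : j ≤ ConeFace.depth (ConeFace.dualCone Ω)) :
    -- the vectors `e_F(E)` are well defined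
    (∀ q : ConeFace.flags (ConeFace.dualCone Ω) j,
      ConeFace.IsNormalisedGenerator q.1.1.carrier q.1.2.carrier
        (ConeFace.normGen q.1.1.carrier q.1.2.carrier)) ∧
    -- `ξ(𝒫_j) × X` is a manifold over `ξ(𝒫_j)`
    FibrewiseC1.IsC10Manifold
      (Prod.fst : ConeFace.flagBase (ConeFace.dualCone Ω) j × X →
        ConeFace.flagBase (ConeFace.dualCone Ω) j)
      (FibrewiseC1.productAtlas (ConeFace.flagBase (ConeFace.dualCone Ω) j) X) ∧
    -- the image of `(ξ, 𝐞)` is a closed submanifold of it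
    IsClosed (Set.range (ConeFace.flagMap (ConeFace.dualCone Ω) j)) ∧
    FibrewiseC1.IsC10Submanifold (ConeFace.fibreDim (ConeFace.dualCone Ω) j)
      (Set.range (ConeFace.flagMap (ConeFace.dualCone Ω) j)) ∧
    -- this defines a manifold structure on `𝒫_j` over `ξ(𝒫_j)`
    Topology.IsEmbedding (ConeFace.flagMap (ConeFace.dualCone Ω) j) ∧
    FibrewiseC1.IsC10Manifold (ConeFace.flagProj (ConeFace.dualCone Ω) j)
      (FibrewiseC1.inducedAtlas (ConeFace.fibreDim (ConeFace.dualCone Ω) j)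
        (ConeFace.flagMap (ConeFace.dualCone Ω) j)) ∧
    -- the fibrewise tangent space at `(E, F)` is `E_{1/2}(F)`
    ∀ q : ConeFace.flags (ConeFace.dualCone Ω) j,
      ∀ φ ∈ FibrewiseC1.inducedAtlas (ConeFace.fibreDim (ConeFace.dualCone Ω) j)
        (ConeFace.flagMap (ConeFace.dualCone Ω) j), q ∈ φ.source →
      FibrewiseC1.fibreTangentSpace (ConeFace.flagMap (ConeFace.dualCone Ω) j) φ q =
        ConeFace.halfSpace q.1.1.carrier q.1.2.carrier := by
  have h : ConeFace.Admissible (ProperCone.innerDual (Ω : Set X)) j := ⟨hcompact, hsmooth, hj, hjd⟩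
  have := h.compactSpace_flags
  exact ⟨h.isNormalisedGenerator, h.isC10Manifold_product,
    h.isClosedEmbedding_flagMap.isClosed_range,
    h.hasSecantSpaces.isC10Submanifold h.finrank_halfSpace,
    h.isClosedEmbedding_flagMap.isEmbedding, h.isC10Manifold_flags,
    fun q _ hφ hq => h.fibreTangentSpace_eq q hφ hq⟩
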